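/- **Conventions.** A spectrum is a sequence of based spaces $X_n$ ($n\ge 0$) with structure maps $X_n\to\Omega X_{n+1}$; a map of spectra is a sequence of based maps commuting with the structure maps; a weak equivalence is a map inducing isomorphisms on $\pi_i(X)=\operatorname{colim}_n\pi_{i+n}(X_n)$ for all $i\in\mathbb Z$; $\operatorname{Ho}$ is the category of spectra localized at the weak equivalences. A homology theory $E_*$ is a family of functors $E_n\colon \operatorname{Ho}\to\mathrm{Ab}$, $n\in\mathbb Z$, with natural boundary maps giving, for every map of spectra $f\colon X\to Y$, a long exact sequence $$\cdots\to E_{n+1}(X)\to E_{n+1}(Y)\to E_n(\operatorname{hofiber} f)\to E_n(X)\to E_n(Y)\to\cdots;$$ a cohomology theory $E^*$ is defined in the same way, with contravariant functors and the arrows reversed. A $k$-dimensional cube of spectra ($k\ge 0$) is a functor $\chi$ from the poset of subsets of $\underline k=\{1,\dots,k\}$ to spectra. Its total homotopy fiber $\operatorname{tfiber}\chi$ is the homotopy fiber of the natural map $\chi(\emptyset)\to\operatorname{holim}_{\emptyset\ne S\subset\underline k}\chi(S)$. The cube $\chi$ is *retractive* if for all $U\subset\underline k$ and $i\notin U$ there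 is a homotopy section $\chi(U\cup\{i\})\to\chi(U)$ of the map $\chi(U)\to\chi(U\cup\{i\})$, i.e. a morphism for which the composite $\chi(U\cup\{i\})\to\chi(U)\to\chi(U\cup\{i\})$ is a weak equivalence, and these can be chosen so that * the cube of sections commutes up to homotopy: for $i\ne j$ not in $U$, the two composites of sections $\chi(U\cup\{i,j\})\to\chi(U)$ (through $\chi(U\cup\{i\})$ and through $\chi(U\cup\{j\})$) agree; * the mixed squares commute up to homotopy: for $i<j$ not in $U$, the composite $\chi(U\cup\{j\})\to\chi(U)\to\chi(U\cup\{i\})$ (section, then map of $\chi$) agrees with $\chi(U\cup\{j\})\to\chi(U\cup\{i,j\})\to\chi(U\cup\{i\})$ (map of $\chi$, then section). Here sections are morphisms of $\operatorname{Ho}$, and "weak equivalence" and "up to homotopy" mean isomorphism and equality in $\operatorname{Ho}$; this includes the case of actual maps of spectra and homotopies. **Lemma.** Let $\chi$ be a retractive $k$-dimensional cube of spectra. 1. For every homology theory $E_*$ and every $n\in\mathbb Z$, the map $E_n(\operatorname{tfiber}\chi)\to E_n(\chi(\emptyset))$ induced by the canonical map $\operatorname{tfiber}\chi\to\chi(\emptyset)$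 is a split monomorphism (so $E_n(\operatorname{tfiber}\chi)$ is a direct summand of $E_n(\chi(\emptyset))$), and it induces an isomorphism $$E_n(\operatorname{tfiber}\chi)\xrightarrow{\ \cong\ }\operatorname{tkernel}(E_n\chi):=\ker\Bigl(E_n(\chi(\emptyset))\to\prod_{i=1}^kE_n(\chi(\{i\}))\Bigr).$$ 2. For every cohomology theory $E^*$ and every $n\in\mathbb Z$, the map $E^n(\chi(\emptyset))\to E^n(\operatorname{tfiber}\chi)$ induced by the canonical map is a split epimorphism (so $E^n(\operatorname{tfiber}\chi)$ is a direct summand of $E^n(\chi(\emptyset))$), and it induces an isomorphism $$\operatorname{tcokernel}(E^n\chi):=\operatorname{coker}\Bigl(\bigoplus_{i=1}^kE^n(\chi(\{i\}))\to E^n(\chi(\emptyset))\Bigr)\xrightarrow{\ \cong\ }E^n(\operatorname{tfiber}\chi).$$ -/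

import Mathlib

open CategoryTheory Limits
open scoped unitInterval

universe u w

namespace CubeSpectra

/-! ### Based spaces -/

/-- A based topological space. -/
structure BasedSpace : Type (u + 1) where
  carrier : Type u
  [top : TopologicalSpace carrier]
  pt : carrier

namespace BasedSpace

instance : CoeSort BasedSpace.{u} (Type u) := ⟨carrier⟩

instance (X : BasedSpace.{u}) : TopologicalSpace X := X.top

/-- A basepoint-preserving continuous map. -/
@[ext]
structure Hom (X Y : BasedSpace.{u}) where
  toMap : C(X, Y)
  map_pt : toMap X.pt = Y.pt

instance : Category BasedSpace.{u} where
  Hom X Y := Hom X Y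
  id X := ⟨ContinuousMap.id X, rfl⟩
  comp f g := ⟨g.toMap.comp f.toMap, by simp [f.map_pt, g.map_pt]⟩

@[ext]
lemma hom_ext {X Y : BasedSpace.{u}} {f g : X ⟶ Y} (h : ∀ x, f.toMap x = g.toMap x) : f = g :=
  Hom.ext (ContinuousMap.ext h)

@[simp] lemma id_toMap (X : BasedSpace.{u}) (x : X) : Hom.toMap (𝟙 X) x = x := rfl

@[simp] lemma comp_toMap {X Y Z : BasedSpace.{u}} (f : X ⟶ Y) (g : Y ⟶ Z) (x : X) :
    Hom.toMap (f ≫ g) x = g.toMap (f.toMap x) := rfl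

/-- The based loop space `Ω X`, with the compact-open topology and the constant loop as
basepoint. -/
def loop (X : BasedSpace.{u}) : BasedSpace.{u} where
  carrier := LoopSpace X X.pt
  pt := Path.refl X.pt

/-- Build a based map `X ⟶ Ω Y` from a jointly continuous family of loops. -/
def toLoop {X Y : BasedSpace.{u}} (F : X → I → Y) (hF : Continuous (Function.uncurry F))
    (h0 : ∀ x, F x 0 = Y.pt) (h1 : ∀ x, F x 1 = Y.pt) (hpt : ∀ t, F X.pt t = Y.pt) :
    X ⟶ loop Y where
  toMap :=
    { toFun := fun x =>
        ({ toFun := F x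
           continuous_toFun := hF.comp (Continuous.prodMk_right x)
           source' := h0 x
           target' := h1 x } : Path Y.pt Y.pt)
      continuous_toFun := Path.continuous_uncurry_iff.1 hF }
  map_pt := Path.ext (funext hpt)

/-- Evaluation of a loop. -/
def ev {X : BasedSpace.{u}} (γ : loop X) (t : I) : X := (show Path X.pt X.pt from γ) t

@[simp] lemma ev_toLoop {X Y : BasedSpace.{u}} (F : X → I → Y)
    (hF : Continuous (Function.uncurry F)) (h0 : ∀ x, F x 0 = Y.pt) (h1 : ∀ x, F x 1 = Y.pt)
    (hpt : ∀ t, F X.pt t = Y.pt) (x : X) (t : I) :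
    ev ((toLoop F hF h0 h1 hpt).toMap x) t = F x t := rfl

lemma loop_ext {X : BasedSpace.{u}} {γ γ' : loop X} (h : ∀ t, ev γ t = ev γ' t) : γ = γ' :=
  Path.ext (funext h)

@[simp] lemma ev_zero {X : BasedSpace.{u}} (γ : loop X) : ev γ 0 = X.pt := Path.source _
@[simp] lemma ev_one {X : BasedSpace.{u}} (γ : loop X) : ev γ 1 = X.pt := Path.target _
@[simp] lemma ev_pt {X : BasedSpace.{u}} (t : I) : ev (loop X).pt t = X.pt := rfl

lemma continuous_ev {X : BasedSpace.{u}} : Continuous (fun p : loop X × I => ev p.1 p.2) :=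
  Path.continuous_uncurry_iff.2 (continuous_id (X := Path X.pt X.pt))

/-- The map `Ω f : Ω X ⟶ Ω Y`. -/
def loopMap {X Y : BasedSpace.{u}} (f : X ⟶ Y) : loop X ⟶ loop Y :=
  toLoop (fun γ t => f.toMap (ev γ t)) (f.toMap.continuous.comp continuous_ev)
    (by simp [f.map_pt]) (by simp [f.map_pt]) (by simp [f.map_pt])

@[simp] lemma ev_loopMap {X Y : BasedSpace.{u}} (f : X ⟶ Y) (γ : loop X) (t : I) :
    ev ((loopMap f).toMap γ) t = f.toMap (ev γ t) := rfl

lemma loopMap_id (X : BasedSpace.{u}) : loopMap (𝟙 X) = 𝟙 (loop X) :=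
  hom_ext fun _ => loop_ext fun _ => rfl

lemma loopMap_comp {X Y Z : BasedSpace.{u}} (f : X ⟶ Y) (g : Y ⟶ Z) :
    loopMap (f ≫ g) = loopMap f ≫ loopMap g :=
  hom_ext fun _ => loop_ext fun _ => rfl

/-- The iterated loop space functor `Ω^m`. -/
def loops : ℕ → BasedSpace.{u} ⥤ BasedSpace.{u}
  | 0 => 𝟭 _
  | m + 1 => { obj := loop, map := loopMap, map_id := loopMap_id, map_comp := loopMap_comp } ⋙
      loops m

/-- The functor `π₀` (path components). -/
def pi0 : BasedSpace.{u} ⥤ Type u where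
  obj X := ZerothHomotopy X
  map {X Y} f := ↾(Quotient.map f.toMap fun _ _ h => h.map f.toMap.continuous)
  map_id X := by ext ⟨x⟩; rfl
  map_comp f g := by ext ⟨x⟩; rfl

/-- The homotopy fibre of a based map `f : X ⟶ Y`: points `x` of `X` together with a path in `Y`
from `f x` to the basepoint. -/
def hofiber {X Y : BasedSpace.{u}} (f : X ⟶ Y) : BasedSpace.{u} where
  carrier := {p : X × C(I, Y) // p.2 0 = f.toMap p.1 ∧ p.2 1 = Y.pt}
  pt := ⟨(X.pt, ContinuousMap.const I Y.pt), by simp [f.map_pt]⟩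

end BasedSpace

open BasedSpace

/-! ### Spectra -/

/-- A (sequential) spectrum: based spaces `E_n` with structure maps `E_n → Ω E_{n+1}`. -/
structure Spectrum : Type (u + 1) where
  space : ℕ → BasedSpace.{u}
  str : ∀ n, space n ⟶ loop (space (n + 1))

namespace Spectrum

/-- A map of spectra: levelwise based maps commuting with the structure maps. -/
@[ext]
structure Hom (E F : Spectrum.{u}) where
  map : ∀ n, E.space n ⟶ F.space n
  comm : ∀ n, E.str n ≫ loopMap (map (n + 1)) = map n ≫ F.str n

instance : Category Spectrum.{u} where
  Hom E F := Hom E F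
  id E := ⟨fun n => 𝟙 _, fun n => by simp [loopMap_id]⟩
  comp f g := ⟨fun n => f.map n ≫ g.map n, fun n => by
    rw [loopMap_comp, ← Category.assoc, f.comm, Category.assoc, g.comm, Category.assoc]⟩

@[simp] lemma id_map (E : Spectrum.{u}) (n : ℕ) : Hom.map (𝟙 E) n = 𝟙 (E.space n) := rfl

@[simp] lemma comp_map {E F G : Spectrum.{u}} (f : E ⟶ F) (g : F ⟶ G) (n : ℕ) :
    Hom.map (f ≫ g) n = f.map n ≫ g.map n := rfl

/-- Pointwise form of the compatibility of a map of spectra with the structure maps. -/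
lemma Hom.comm_apply {E F : Spectrum.{u}} (f : E ⟶ F) (n : ℕ) (x : E.space n) (t : I) :
    (f.map (n + 1)).toMap (ev ((E.str n).toMap x) t) = ev ((F.str n).toMap ((f.map n).toMap x)) t :=
  congrArg (fun h : E.space n ⟶ loop (F.space (n + 1)) => ev (h.toMap x) t) (f.comm n)

/-- The sequence `π₀ Ω^{a+n} E_{b+n} → π₀ Ω^{a+n+1} E_{b+n+1} → ⋯` induced by the structure maps;
its `n`-th term is `π_{a+n}(E_{b+n})`. -/
def homotopySeq (a b : ℕ) (E : Spectrum.{u}) : ℕ ⥤ Type u :=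
  Functor.ofSequence (X := fun n => pi0.obj ((loops (a + n)).obj (E.space (b + n))))
    fun n => pi0.map ((loops (a + n)).map (E.str (b + n)))

/-- The map of sequences induced by a map of spectra. -/
def homotopySeqMap (a b : ℕ) {E F : Spectrum.{u}} (f : E ⟶ F) :
    homotopySeq a b E ⟶ homotopySeq a b F :=
  NatTrans.ofSequence (fun n => pi0.map ((loops (a + n)).map (f.map (b + n)))) fun n => by
    have h := congrArg (fun g => pi0.map ((loops (a + n)).map g)) (f.comm (b + n))
    simp only [Functor.map_comp] at h
    unfold homotopySeq
    rw [Functor.ofSequence_map_homOfLE_succ, Functor.ofSequence_map_homOfLE_succ]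
    exact h

/-- The underlying set of the stable homotopy group `π_{a-b}(E) = colim_n π_{a+n}(E_{b+n})`. -/
noncomputable def homotopy (a b : ℕ) (E : Spectrum.{u}) : Type u :=
  colimit (homotopySeq a b E)

/-- The map induced by a map of spectra on `π_{a-b}`. -/
noncomputable def homotopyMap (a b : ℕ) {E F : Spectrum.{u}} (f : E ⟶ F) :
    homotopy a b E → homotopy a b F :=
  ↾(colimMap (homotopySeqMap a b f))

/-- Weak equivalences of spectra: maps inducing isomorphisms on `π_i` for all integers
`i = a - b`. -/
def weakEquivalence : MorphismProperty Spectrum.{u} := fun _ _ f =>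
  ∀ a b : ℕ, Function.Bijective (homotopyMap a b f)

/-- The homotopy category of spectra: the localization at the weak equivalences. -/
abbrev Ho : Type (u + 1) := (weakEquivalence.{u}).Localization

/-- The canonical functor from spectra to the homotopy category. -/
abbrev toHo : Spectrum.{u} ⥤ Ho.{u} := (weakEquivalence.{u}).Q

/-! ### Homotopy fibres of maps of spectra -/

/-- The levelwise homotopy fibre of a map of spectra. The structure map sends `(x, γ)` to the loop
`t ↦ (σ(x)(t), s ↦ σ(γ(s))(t))`. -/
def hofiber {E F : Spectrum.{u}} (f : E ⟶ F) : Spectrum.{u} where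
  space n := BasedSpace.hofiber (f.map n)
  str n := toLoop
    (fun p t => ⟨(ev ((E.str n).toMap p.1.1) t,
        ⟨fun s => ev ((F.str n).toMap (p.1.2 s)) t,
          continuous_ev.comp (((F.str n).toMap.continuous.comp p.1.2.continuous).prodMk
            continuous_const)⟩),
      by simp [p.2.1, Hom.comm_apply], by simp [p.2.2, (F.str n).map_pt]⟩)
    (by
      refine Continuous.subtype_mk (Continuous.prodMk ?_ ?_) _
      · exact continuous_ev.comp (((E.str n).toMap.continuous.comp
          (continuous_fst.comp (continuous_subtype_val.comp continuous_fst))).prodMk continuous_snd)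
      · refine ContinuousMap.continuous_of_continuous_uncurry _ ?_
        refine continuous_ev.comp (Continuous.prodMk ((F.str n).toMap.continuous.comp ?_)
          (continuous_snd.comp continuous_fst))
        exact ContinuousEval.continuous_eval.comp ((continuous_snd.comp
          (continuous_subtype_val.comp (continuous_fst.comp continuous_fst))).prodMk
            continuous_snd))
    (fun p => Subtype.ext (Prod.ext (by simp [BasedSpace.hofiber])
      (ContinuousMap.ext fun s => by simp [BasedSpace.hofiber])))
    (fun p => Subtype.ext (Prod.ext (by simp [BasedSpace.hofiber])
      (ContinuousMap.ext fun s => by simp [BasedSpace.hofiber])))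
    (fun t => Subtype.ext (Prod.ext (by simp [BasedSpace.hofiber, (E.str n).map_pt])
      (ContinuousMap.ext fun s => by simp [BasedSpace.hofiber, (F.str n).map_pt])))

/-- The canonical map from the homotopy fibre of `f : E ⟶ F` to `E`. -/
def hofiberι {E F : Spectrum.{u}} (f : E ⟶ F) : hofiber f ⟶ E where
  map _ :=
    { toMap := ⟨fun p => p.1.1, continuous_fst.comp continuous_subtype_val⟩
      map_pt := rfl }
  comm _ := BasedSpace.hom_ext fun _ => loop_ext fun _ => rfl

/-- The map of homotopy fibres induced by a commutative square of spectra. -/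
def hofiberMap {E F E' F' : Spectrum.{u}} (f : E ⟶ F) (f' : E' ⟶ F') (a : E ⟶ E') (b : F ⟶ F')
    (h : f ≫ b = a ≫ f') : hofiber f ⟶ hofiber f' where
  map n :=
    { toMap :=
        { toFun := fun p => ⟨((a.map n).toMap p.1.1, (b.map n).toMap.comp p.1.2),
            by
              have := congrArg (fun g : E ⟶ F' => (g.map n).toMap p.1.1) h
              simpa [p.2.1] using this,
            by simp [p.2.2, (b.map n).map_pt]⟩
          continuous_toFun := Continuous.subtype_mk
            (((a.map n).toMap.continuous.comp (continuous_fst.comp continuous_subtype_val)).prodMk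
              ((ContinuousMap.continuous_postcomp _).comp
                (continuous_snd.comp continuous_subtype_val))) _ }
      map_pt := Subtype.ext (Prod.ext (a.map n).map_pt
        (ContinuousMap.ext fun _ => (b.map n).map_pt)) }
  comm n := BasedSpace.hom_ext fun p => loop_ext fun t => Subtype.ext (Prod.ext
    (Hom.comm_apply a n p.1.1 t) (ContinuousMap.ext fun s => Hom.comm_apply b n (p.1.2 s) t))

end Spectrum

open Spectrum

/-! ### Cubes of spectra and their total homotopy fibres -/

/-- A `k`-dimensional cubical diagram in `C`: a functor on the poset of subsets of a
`k`-element set. -/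
abbrev Cube (k : ℕ) (C : Type*) [Category C] := Finset (Fin k) ⥤ C

/-- The nonempty subsets of the `k`-element set. -/
abbrev NonemptySubset (k : ℕ) := {S : Finset (Fin k) // S.Nonempty}

/-- The map `Δ^S → Δ^T` of topological simplices spanned by finite sets `S ⊆ T`
(inclusion of a face). -/
noncomputable def face {k : ℕ} {S T : Finset (Fin k)} (h : S ⊆ T) :
    C(stdSimplex ℝ S, stdSimplex ℝ T) :=
  ⟨stdSimplex.map (Set.inclusion h), stdSimplex.continuous_map _⟩

namespace Cube

variable {k : ℕ} (χ : Cube k Spectrum.{u})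

/-- The homotopy limit of the based spaces `χ(S)_n` over the nonempty subsets `S`, as the space of
compatible families of maps `Δ^S → χ(S)_n` (the simplex `Δ^S` is the realization of the nerve of
the poset of nonempty subsets of `S`, by barycentric subdivision). -/
def puncturedHolimSpace (n : ℕ) : BasedSpace.{u} where
  carrier := {Ψ : ∀ S : NonemptySubset k, C(stdSimplex ℝ S.1, (χ.obj S.1).space n) //
    ∀ (S T : NonemptySubset k) (h : S.1 ⊆ T.1) (p : stdSimplex ℝ S.1),
      ((χ.map (homOfLE h)).map n).toMap (Ψ S p) = Ψ T (face h p)}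
  pt := ⟨fun S => ContinuousMap.const _ ((χ.obj S.1).space n).pt,
    fun _ _ h _ => ((χ.map (homOfLE h)).map n).map_pt⟩

/-- The homotopy limit `holim_{∅ ≠ S} χ(S)`, formed levelwise, with structure map sending a family
`Ψ` to the loop `t ↦ (p ↦ σ(Ψ_S(p))(t))`. (Finite homotopy limits commute with the sequential
colimits defining stable homotopy groups, so no replacement by Ω-spectra is needed.) -/
def puncturedHolim : Spectrum.{u} where
  space n := puncturedHolimSpace χ n
  str n := toLoop
    (fun Ψ t => ⟨fun S => ⟨fun p => ev (((χ.obj S.1).str n).toMap (Ψ.1 S p)) t,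
        continuous_ev.comp ((((χ.obj S.1).str n).toMap.continuous.comp
          (Ψ.1 S).continuous).prodMk continuous_const)⟩,
      fun S T h p => by
        simp only [ContinuousMap.coe_mk, Hom.comm_apply, Ψ.2 S T h p]⟩)
    (by
      refine Continuous.subtype_mk (continuous_pi fun S => ?_) _
      refine ContinuousMap.continuous_of_continuous_uncurry _ ?_
      refine continuous_ev.comp (Continuous.prodMk
        (((χ.obj S.1).str n).toMap.continuous.comp ?_) (continuous_snd.comp continuous_fst))
      exact ContinuousEval.continuous_eval.comp (((continuous_apply S).comp
          (continuous_subtype_val.comp (continuous_fst.comp continuous_fst))).prodMk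
            continuous_snd))
    (fun Ψ => Subtype.ext (funext fun S => ContinuousMap.ext fun p => by
      simp [puncturedHolimSpace]))
    (fun Ψ => Subtype.ext (funext fun S => ContinuousMap.ext fun p => by
      simp [puncturedHolimSpace]))
    (fun t => Subtype.ext (funext fun S => ContinuousMap.ext fun p => by
      simp [puncturedHolimSpace, ((χ.obj S.1).str n).map_pt]))

/-- The canonical map `χ(∅) → holim_{∅ ≠ S} χ(S)`, sending a point to the family of constant
maps. -/
def toPuncturedHolim : χ.obj ∅ ⟶ puncturedHolim χ where
  map n :=
    { toMap :=
        { toFun := fun x => ⟨fun S => ContinuousMap.const _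
              (((χ.map (homOfLE (Finset.empty_subset S.1))).map n).toMap x),
            fun S T h p => by
              have e : χ.map (homOfLE (Finset.empty_subset T.1)) =
                  χ.map (homOfLE (Finset.empty_subset S.1)) ≫ χ.map (homOfLE h) := by
                rw [← χ.map_comp, homOfLE_comp]
              exact (congrArg (fun g : χ.obj ∅ ⟶ χ.obj T.1 => (g.map n).toMap x) e).symm⟩
          continuous_toFun := Continuous.subtype_mk (continuous_pi fun S =>
            ContinuousMap.continuous_const'.comp
              ((χ.map (homOfLE (Finset.empty_subset S.1))).map n).toMap.continuous) _ }
      map_pt := Subtype.ext (funext fun S => ContinuousMap.ext fun _ =>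
        ((χ.map (homOfLE (Finset.empty_subset S.1))).map n).map_pt) }
  comm n := BasedSpace.hom_ext fun x => loop_ext fun t => Subtype.ext (funext fun S =>
    ContinuousMap.ext fun _ =>
      Hom.comm_apply (χ.map (homOfLE (Finset.empty_subset S.1))) n x t)

/-- The total homotopy fibre: the homotopy fibre of `χ(∅) → holim_{∅ ≠ S} χ(S)`. -/
def tfiber : Spectrum.{u} := hofiber (toPuncturedHolim χ)

/-- The canonical map `tfiber χ → χ(∅)`. -/
def tfiberι : tfiber χ ⟶ χ.obj ∅ := hofiberι _

/-- The edge `χ(U) → χ(U ∪ {i})` of a cube. -/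
def edge {C : Type*} [Category C] (χ : Cube k C) (U : Finset (Fin k)) (i : Fin k) :
    χ.obj U ⟶ χ.obj (insert i U) :=
  χ.map (homOfLE (Finset.subset_insert i U))

/-- A cube of spectra is retractive if every edge `χ(U) → χ(U ∪ {i})`, `i ∉ U`, has a homotopy
section `s U i` (the composite `χ(U ∪ {i}) → χ(U) → χ(U ∪ {i})` is a weak equivalence), such that
the squares of sections and, for `i < j`, the mixed squares commute up to homotopy. "Up to homotopy"
means in the homotopy category of spectra. -/
def Retractive (χ : Cube k Spectrum.{u}) : Prop :=
  ∃ s : ∀ (U : Finset (Fin k)) (i : Fin k), i ∉ U →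
      (toHo.obj (χ.obj (insert i U)) ⟶ toHo.obj (χ.obj U)),
    (∀ (U : Finset (Fin k)) (i : Fin k) (hi : i ∉ U), IsIso (s U i hi ≫ toHo.map (edge χ U i))) ∧
    (∀ (U : Finset (Fin k)) (i j : Fin k) (hi : i ∉ U) (hj : j ∉ U) (hij : i ≠ j),
      s (insert i U) j (by simp [hj, hij.symm]) ≫ s U i hi =
        eqToHom (by rw [Finset.insert_comm]) ≫
          s (insert j U) i (by simp [hi, hij]) ≫ s U j hj) ∧
    (∀ (U : Finset (Fin k)) (i j : Fin k) (hi : i ∉ U) (hj : j ∉ U) (hij : i < j),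
      s U j hj ≫ toHo.map (edge χ U i) =
        toHo.map (edge χ (insert j U) i) ≫ eqToHom (by rw [Finset.insert_comm]) ≫
          s (insert i U) j (by simp [hj, hij.ne']))

/-- The total kernel of a cube of abelian groups: the kernel of `A(∅) → ∏ i, A({i})`. -/
def tkernel (A : Cube k AddCommGrpCat.{w}) : AddSubgroup (A.obj ∅) :=
  (AddMonoidHom.pi fun i : Fin k =>
    (A.map (homOfLE (Finset.empty_subset {i}))).hom).ker

open scoped DirectSum in
/-- The total cokernel of a contravariant cube of abelian groups: the cokernel of
`⨁ i, A({i}) → A(∅)`. -/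
abbrev tcokernel (A : (Finset (Fin k))ᵒᵖ ⥤ AddCommGrpCat.{w}) : Type w :=
  A.obj (.op ∅) ⧸ (DirectSum.toAddMonoid fun i : Fin k =>
    (A.map (homOfLE (Finset.empty_subset {i})).op).hom).range

end Cube

/-! ### Homology and cohomology theories on spectra -/

/-- A (generalized) homology theory on spectra: functors `E_n`, `n ∈ ℤ`, from the homotopy category
of spectra to abelian groups, with natural boundary maps giving a long exact sequence
`⋯ → E_{n+1}(X) → E_{n+1}(Y) → E_n(hofiber f) → E_n(X) → E_n(Y) → ⋯`
for every homotopy fibration sequence `hofiber f → X → Y` of spectra (for spectra, homotopy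
fibration and cofibration sequences agree up to weak equivalence). Being defined on the homotopy
category amounts to sending weak equivalences to isomorphisms. No wedge axiom is required. -/
structure HomologyTheory where
  obj : ℤ → Ho.{u} ⥤ AddCommGrpCat.{w}
  δ {X Y : Spectrum.{u}} (f : X ⟶ Y) (n : ℤ) :
    (obj (n + 1)).obj (toHo.obj Y) ⟶ (obj n).obj (toHo.obj (hofiber f))
  δ_natural {X Y X' Y' : Spectrum.{u}} (f : X ⟶ Y) (f' : X' ⟶ Y') (a : X ⟶ X') (b : Y ⟶ Y')
    (h : f ≫ b = a ≫ f') (n : ℤ) :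
    δ f n ≫ (obj n).map (toHo.map (hofiberMap f f' a b h)) =
      (obj (n + 1)).map (toHo.map b) ≫ δ f' n
  exact_left {X Y : Spectrum.{u}} (f : X ⟶ Y) (n : ℤ) :
    Function.Exact (δ f n).hom ((obj n).map (toHo.map (hofiberι f))).hom
  exact_middle {X Y : Spectrum.{u}} (f : X ⟶ Y) (n : ℤ) :
    Function.Exact ((obj n).map (toHo.map (hofiberι f))).hom ((obj n).map (toHo.map f)).hom
  exact_right {X Y : Spectrum.{u}} (f : X ⟶ Y) (n : ℤ) :
    Function.Exact ((obj (n + 1)).map (toHo.map f)).hom (δ f n).hom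

/-- A (generalized) cohomology theory on spectra: contravariant functors `E^n`, `n ∈ ℤ`, from the
homotopy category of spectra to abelian groups, with natural coboundary maps giving a long exact
sequence `⋯ → E^n(Y) → E^n(X) → E^n(hofiber f) → E^{n+1}(Y) → E^{n+1}(X) → ⋯`
for every homotopy fibration sequence `hofiber f → X → Y` of spectra. -/
structure CohomologyTheory where
  obj : ℤ → Ho.{u}ᵒᵖ ⥤ AddCommGrpCat.{w}
  δ {X Y : Spectrum.{u}} (f : X ⟶ Y) (n : ℤ) :
    (obj n).obj (.op (toHo.obj (hofiber f))) ⟶ (obj (n + 1)).obj (.op (toHo.obj Y))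
  δ_natural {X Y X' Y' : Spectrum.{u}} (f : X ⟶ Y) (f' : X' ⟶ Y') (a : X ⟶ X') (b : Y ⟶ Y')
    (h : f ≫ b = a ≫ f') (n : ℤ) :
    (obj n).map (toHo.map (hofiberMap f f' a b h)).op ≫ δ f n =
      δ f' n ≫ (obj (n + 1)).map (toHo.map b).op
  exact_left {X Y : Spectrum.{u}} (f : X ⟶ Y) (n : ℤ) :
    Function.Exact ((obj n).map (toHo.map f).op).hom ((obj n).map (toHo.map (hofiberι f)).op).hom
  exact_middle {X Y : Spectrum.{u}} (f : X ⟶ Y) (n : ℤ) :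
    Function.Exact ((obj n).map (toHo.map (hofiberι f)).op).hom (δ f n).hom
  exact_right {X Y : Spectrum.{u}} (f : X ⟶ Y) (n : ℤ) :
    Function.Exact (δ f n).hom ((obj (n + 1)).map (toHo.map f).op).hom

/-- The group `E_n(X)` of a spectrum `X`, as a functor of `X`. -/
noncomputable abbrev HomologyTheory.onSpectra (E : HomologyTheory.{u, w}) (n : ℤ) :
    Spectrum.{u} ⥤ AddCommGrpCat.{w} :=
  toHo ⋙ E.obj n

/-- The group `E^n(X)` of a spectrum `X`, as a contravariant functor of `X`. -/
noncomputable abbrev CohomologyTheory.onSpectra (E : CohomologyTheory.{u, w}) (n : ℤ) :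
    Spectrum.{u}ᵒᵖ ⥤ AddCommGrpCat.{w} :=
  toHo.op ⋙ E.obj n

end CubeSpectra

namespace CubeSpectra

open BasedSpace Spectrum

/-! The total homotopy fibre can be computed by taking homotopy fibres in one direction at a time.
In direction `j` one takes the homotopy fibre of a map `f : X ⟶ Y` between the iterated fibres of
two opposite faces, formed in the directions already treated. By induction `E_n(X)` and `E_n(Y)` are
direct summands of the groups `M = E_n(χ(B))` and `N = E_n(χ(B ∪ {j}))` of the initial vertices,
namely the common kernels `K` and `L` of the edges in the earlier directions.

The homotopy sections live only in `Ho`, so they need not induce maps of homotopy fibres. Maps of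
groups suffice: by the mixed squares the section `N → M` carries `L` into `K`, and the inverse of
the automorphism "section, then edge" of `N` preserves `L`. Hence `E_n(f)` has a right inverse in
every degree, the long exact sequence breaks into split short exact sequences, and `E_n(hofiber f)`
is the summand `K ∩ ker(M → N)` of `M`. The mixed squares combine a section in direction `j` with an
edge in a direction `i < j`, so the directions are treated in increasing order. Cohomology is dual,
with quotients by sums of images. This is `homology_iterFiber` and `cohomology_iterFiber`.

Geometrically, a point of the iterated fibre is a compatible family of maps `I^S → χ(S)` sending the
faces `t i = 1` to the basepoint. Currying one coordinate exhibits it as a homotopy fibre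
(`isIso_iterFiberCurry`). For nonempty `S`, the cube `I^S` is the cone from the origin on the union
of these faces, which projects radially onto `Δ^S`. Such a family is therefore a path of families
`Δ^S → χ(S)` from a constant family to the basepoint, that is, a point of the total fibre
(`isIso_iterFiberToTfiber`). Both comparisons are isomorphisms of spectra, not merely weak
equivalences. -/

lemma BasedSpace.continuous_hofiber_val {X Y : BasedSpace.{u}} (f : X ⟶ Y) :
    Continuous fun p : BasedSpace.hofiber f => (p.1 : X × C(I, Y)) :=
  continuous_subtype_val

namespace Spectrum

/-- A map of spectra with levelwise based inverses is an isomorphism. -/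
def isoOfLevelwise {E F : Spectrum.{u}} (f : E ⟶ F) (g : ∀ n, F.space n ⟶ E.space n)
    (hfg : ∀ n, f.map n ≫ g n = 𝟙 _) (hgf : ∀ n, g n ≫ f.map n = 𝟙 _) : E ≅ F where
  hom := f
  inv :=
    { map := g
      comm := fun n => by
        have h := congrArg (fun q => g n ≫ q ≫ loopMap (g (n + 1))) (f.comm n)
        simp only [Category.assoc, ← loopMap_comp, hfg, loopMap_id, Category.comp_id] at h
        rw [h, ← Category.assoc (g n), hgf, Category.id_comp] }
  hom_inv_id := Hom.ext (funext hfg)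
  inv_hom_id := Hom.ext (funext hgf)

end Spectrum

/-! ### Iterated homotopy fibres of faces of a cube -/

namespace Cube

variable {k : ℕ} (χ : Cube k Spectrum.{u})

lemma map_map_apply {S T U : Finset (Fin k)} (h : S ⊆ T) (h' : T ⊆ U) (n : ℕ)
    (x : (χ.obj S).space n) :
    ((χ.map (homOfLE h')).map n).toMap (((χ.map (homOfLE h)).map n).toMap x) =
      ((χ.map (homOfLE (h.trans h'))).map n).toMap x := by
  have e : χ.map (homOfLE (h.trans h')) = χ.map (homOfLE h) ≫ χ.map (homOfLE h') := by
    rw [← χ.map_comp, homOfLE_comp]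
  rw [e]; rfl

lemma map_self_apply {S : Finset (Fin k)} (h : S ⊆ S) (n : ℕ) (x : (χ.obj S).space n) :
    ((χ.map (homOfLE h)).map n).toMap x = x := by
  have e : χ.map (homOfLE h) = 𝟙 _ := χ.map_id S
  rw [e]; rfl

/-- The subsets `S` with `B ⊆ S ⊆ C`. -/
abbrev Between (B C : Finset (Fin k)) := {S : Finset (Fin k) // B ⊆ S ∧ S ⊆ C}

/-- The `n`-th space of the iterated homotopy fibre of the cube `χ(S)`, `B ⊆ S ⊆ C`: compatible
families of maps `I^{S \ B} → χ(S)_n` sending every face `t i = 1` to the basepoint. The maps are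
written as functions on `I^k` that depend only on the coordinates in `S \ B`. -/
def iterFiberSpace (B C : Finset (Fin k)) (n : ℕ) : BasedSpace.{u} where
  carrier := {Φ : ∀ S : Between B C, C(Fin k → I, (χ.obj S.1).space n) //
    (∀ (S T : Between B C) (h : S.1 ⊆ T.1) (t t' : Fin k → I),
      (∀ i ∈ S.1, i ∉ B → t i = t' i) → (∀ i ∈ T.1, i ∉ S.1 → t' i = 0) →
        ((χ.map (homOfLE h)).map n).toMap (Φ S t) = Φ T t') ∧
    ∀ (S : Between B C) (t : Fin k → I), ∀ i ∈ S.1, i ∉ B → t i = 1 →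
      Φ S t = ((χ.obj S.1).space n).pt}
  pt := ⟨fun S => ContinuousMap.const _ ((χ.obj S.1).space n).pt,
    fun _ _ h _ _ _ _ => ((χ.map (homOfLE h)).map n).map_pt, fun _ _ _ _ _ _ => rfl⟩

variable {χ} {B C : Finset (Fin k)} {n : ℕ}

/-- Evaluation of a point of the iterated homotopy fibre. -/
def iterFiberEval (Φ : iterFiberSpace χ B C n) (S : Between B C) :
    C(Fin k → I, (χ.obj S.1).space n) :=
  (show {_Φ : ∀ S : Between B C, C(Fin k → I, (χ.obj S.1).space n) // _} from Φ).1 S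

lemma iterFiber_ext {Φ Ψ : iterFiberSpace χ B C n}
    (h : ∀ S t, iterFiberEval Φ S t = iterFiberEval Ψ S t) : Φ = Ψ :=
  Subtype.ext (funext fun S => ContinuousMap.ext (h S))

lemma iterFiber_compat (Φ : iterFiberSpace χ B C n) (S T : Between B C) (h : S.1 ⊆ T.1)
    (t t' : Fin k → I) (h₁ : ∀ i ∈ S.1, i ∉ B → t i = t' i) (h₂ : ∀ i ∈ T.1, i ∉ S.1 → t' i = 0) :
    ((χ.map (homOfLE h)).map n).toMap (iterFiberEval Φ S t) = iterFiberEval Φ T t' :=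
  Φ.2.1 S T h t t' h₁ h₂

lemma iterFiber_boundary (Φ : iterFiberSpace χ B C n) (S : Between B C) (t : Fin k → I)
    {i : Fin k} (hi : i ∈ S.1) (hi' : i ∉ B) (h : t i = 1) :
    iterFiberEval Φ S t = ((χ.obj S.1).space n).pt :=
  Φ.2.2 S t i hi hi' h

/-- The compatibility condition with `S = T` already encodes independence of the coordinates outside
`S \ B`. -/
lemma iterFiber_congr (Φ : iterFiberSpace χ B C n) (S : Between B C) {t t' : Fin k → I}
    (h : ∀ i ∈ S.1, i ∉ B → t i = t' i) : iterFiberEval Φ S t = iterFiberEval Φ S t' := by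
  rw [← iterFiber_compat Φ S S subset_rfl t t' h fun i hi hi' => absurd hi hi', map_self_apply]

@[simp] lemma iterFiberEval_pt (S : Between B C) (t : Fin k → I) :
    iterFiberEval (iterFiberSpace χ B C n).pt S t = ((χ.obj S.1).space n).pt := rfl

lemma continuous_iterFiberEval (S : Between B C) : Continuous
    fun p : iterFiberSpace χ B C n × (Fin k → I) => iterFiberEval p.1 S p.2 :=
  ContinuousEval.continuous_eval.comp (((continuous_apply S).comp
    (continuous_subtype_val.comp continuous_fst)).prodMk continuous_snd)

lemma continuous_to_iterFiber {X : Type*} [TopologicalSpace X] {F : X → iterFiberSpace χ B C n}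
    (h : ∀ S, Continuous fun p : X × (Fin k → I) => iterFiberEval (F p.1) S p.2) :
    Continuous F :=
  continuous_induced_rng.2 (continuous_pi fun S =>
    ContinuousMap.continuous_of_continuous_uncurry _ (h S))

/-- Build a point of the iterated homotopy fibre. -/
def iterFiberMk (Φ : ∀ S : Between B C, (Fin k → I) → (χ.obj S.1).space n)
    (hc : ∀ S, Continuous (Φ S))
    (h : ∀ (S T : Between B C) (h : S.1 ⊆ T.1) (t t' : Fin k → I),
      (∀ i ∈ S.1, i ∉ B → t i = t' i) → (∀ i ∈ T.1, i ∉ S.1 → t' i = 0) →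
        ((χ.map (homOfLE h)).map n).toMap (Φ S t) = Φ T t')
    (h' : ∀ (S : Between B C) (t : Fin k → I), ∀ i ∈ S.1, i ∉ B → t i = 1 →
      Φ S t = ((χ.obj S.1).space n).pt) : iterFiberSpace χ B C n :=
  (⟨fun S => ⟨Φ S, hc S⟩, h, h'⟩ : {_Φ : ∀ S : Between B C, C(Fin k → I, (χ.obj S.1).space n) // _})

@[simp] lemma iterFiberEval_mk (Φ : ∀ S : Between B C, (Fin k → I) → (χ.obj S.1).space n)
    (hc h h') (S : Between B C) (t : Fin k → I) :
    iterFiberEval (iterFiberMk Φ hc h h') S t = Φ S t := rfl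

variable (χ) in
/-- The iterated homotopy fibre of the cube `χ(S)`, `B ⊆ S ⊆ C`. -/
def iterFiber (B C : Finset (Fin k)) : Spectrum.{u} where
  space n := iterFiberSpace χ B C n
  str n := toLoop
    (fun Φ u => iterFiberMk (fun S t => ev (((χ.obj S.1).str n).toMap (iterFiberEval Φ S t)) u)
      (fun S => continuous_ev.comp ((((χ.obj S.1).str n).toMap.continuous.comp
          (iterFiberEval Φ S).continuous).prodMk continuous_const))
      (fun S T h t t' h₁ h₂ => by
        rw [Hom.comm_apply, iterFiber_compat Φ S T h t t' h₁ h₂])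
      (fun S t i hi hi' h => by
        rw [iterFiber_boundary Φ S t hi hi' h, ((χ.obj S.1).str n).map_pt, ev_pt]))
    (continuous_to_iterFiber fun S => continuous_ev.comp (Continuous.prodMk
      (((χ.obj S.1).str n).toMap.continuous.comp ((continuous_iterFiberEval S).comp
        ((continuous_fst.comp continuous_fst).prodMk continuous_snd)))
      (continuous_snd.comp continuous_fst)))
    (fun _ => iterFiber_ext fun S t => by simp)
    (fun _ => iterFiber_ext fun S t => by simp)
    (fun u => iterFiber_ext fun S t => by simp [((χ.obj S.1).str n).map_pt])

variable (χ) in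
/-- The projection of the iterated homotopy fibre to the initial vertex. -/
def iterFiberι (h : B ⊆ C) : iterFiber χ B C ⟶ χ.obj B where
  map n :=
    { toMap := ⟨fun Φ => iterFiberEval Φ ⟨B, subset_rfl, h⟩ 0,
        (continuous_iterFiberEval _).comp (continuous_id.prodMk continuous_const)⟩
      map_pt := rfl }
  comm _ := BasedSpace.hom_ext fun _ => loop_ext fun _ => rfl

/-- The iterated homotopy fibre of a single vertex is this vertex. -/
lemma isIso_iterFiberι_self : IsIso (iterFiberι χ (subset_refl B)) := by
  have hS : ∀ S : Between B B, S.1 = B := fun S => S.2.2.antisymm S.2.1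
  refine (isoOfLevelwise (iterFiberι χ (subset_refl B)) (fun n =>
    { toMap := ⟨fun x => iterFiberMk (fun S _ => ((χ.map (homOfLE S.2.1)).map n).toMap x)
          (fun S => continuous_const)
          (fun S T h _ _ _ _ => map_map_apply χ S.2.1 h n x)
          (fun S t i hi hi' => absurd (hS S ▸ hi) hi'),
        continuous_to_iterFiber fun S =>
          ((χ.map (homOfLE S.2.1)).map n).toMap.continuous.comp continuous_fst⟩
      map_pt := iterFiber_ext fun S _ => ((χ.map (homOfLE S.2.1)).map n).map_pt })
    (fun n => BasedSpace.hom_ext fun Φ => iterFiber_ext fun S t => ?_)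
    (fun _ => BasedSpace.hom_ext fun x => map_self_apply χ _ _ x)).isIso_hom
  -- Since `S = B`, no coordinate matters, so the value at an arbitrary `t` is the one at the
  -- origin.
  exact iterFiber_compat Φ ⟨B, _⟩ S S.2.1 0 t (fun i hi hi' => absurd hi hi')
    fun i hi hi' => absurd (hS S ▸ hi) hi'

/-! ### Opposite faces and the homotopy fibre in one direction -/

/-- Removal of the element `j ∉ B`. -/
def Between.erase {j : Fin k} (hj : j ∉ B) (T : Between (insert j B) (insert j C)) : Between B C :=
  ⟨T.1.erase j, by grind⟩

/-- A set containing `B ∪ {j}` contains `B`. -/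
def Between.weaken {j : Fin k} (T : Between (insert j B) C) : Between B C :=
  ⟨T.1, by grind⟩

lemma Between.erase_subset {j : Fin k} (hj : j ∉ B) (T : Between (insert j B) (insert j C)) :
    (T.erase hj).1 ⊆ T.1 :=
  Finset.erase_subset j T.1

lemma Between.erase_mono {j : Fin k} (hj : j ∉ B) {S T : Between (insert j B) (insert j C)}
    (h : S.1 ⊆ T.1) : (S.erase hj).1 ⊆ (T.erase hj).1 :=
  Finset.erase_subset_erase j h

lemma Between.mem {j : Fin k} (T : Between (insert j B) C) : j ∈ T.1 :=
  T.2.1 (Finset.mem_insert_self j B)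

lemma Between.mem_erase {j : Fin k} (hj : j ∉ B) (T : Between (insert j B) (insert j C))
    {i : Fin k} : i ∈ (T.erase hj).1 ↔ i ≠ j ∧ i ∈ T.1 :=
  Finset.mem_erase

variable (χ) in
/-- The map of iterated homotopy fibres in the direction `j`. -/
def iterFiberEdge {j : Fin k} (hj : j ∉ B) :
    iterFiber χ B C ⟶ iterFiber χ (insert j B) (insert j C) where
  map n :=
    { toMap := ⟨fun (Φ : iterFiberSpace χ B C n) => iterFiberMk (fun T t =>
            ((χ.map (homOfLE (T.erase_subset hj))).map n).toMap (iterFiberEval Φ (T.erase hj) t))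
          (fun T => ((χ.map (homOfLE (T.erase_subset hj))).map n).toMap.continuous.comp
            (iterFiberEval Φ (T.erase hj)).continuous)
          (fun S T h t t' h₁ h₂ => by
            rw [map_map_apply, ← iterFiber_compat Φ (S.erase hj) (T.erase hj)
              (Between.erase_mono hj h) t t'
              (fun i hi hi' => h₁ i (S.erase_subset hj hi)
                (by grind [Between.mem_erase]))
              (fun i hi hi' => h₂ i (T.erase_subset hj hi) (by grind [Between.mem_erase])),
              map_map_apply])
          (fun S t i hi hi' h => by
            rw [iterFiber_boundary Φ _ t (i := i) ((S.mem_erase hj).2 (by grind)) (by grind) h]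
            exact ((χ.map (homOfLE (S.erase_subset hj))).map n).map_pt),
        continuous_to_iterFiber fun T =>
          ((χ.map (homOfLE (T.erase_subset hj))).map n).toMap.continuous.comp
            (continuous_iterFiberEval (T.erase hj))⟩
      map_pt := iterFiber_ext fun T _ => ((χ.map (homOfLE (T.erase_subset hj))).map n).map_pt }
  comm n := BasedSpace.hom_ext fun Φ => loop_ext fun t => iterFiber_ext fun T p =>
    Hom.comm_apply (χ.map (homOfLE (T.erase_subset hj))) n (iterFiberEval Φ (T.erase hj) p) t

lemma iterFiberEdge_ι {j : Fin k} (hj : j ∉ B) (h : B ⊆ C) :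
    iterFiberEdge χ hj ≫ iterFiberι χ (Finset.insert_subset_insert j h) =
      iterFiberι χ h ≫ edge χ B j :=
  Spectrum.Hom.ext (funext fun n => BasedSpace.hom_ext fun Φ => by
    let T : Between (insert j B) (insert j C) :=
      ⟨insert j B, subset_rfl, Finset.insert_subset_insert j h⟩
    -- The set `(insert j B).erase j` equals `B` only propositionally; compatibility between the two
    -- vertices replaces a transport.
    have := iterFiber_compat Φ ⟨B, subset_rfl, h⟩ (T.erase hj) (T.erase hj).2.1 0 0
      (fun _ _ _ => rfl) (fun _ _ _ => rfl)
    change ((χ.map (homOfLE (T.erase_subset hj))).map n).toMap (iterFiberEval Φ (T.erase hj) 0) =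
      ((χ.map (homOfLE _)).map n).toMap (iterFiberEval Φ ⟨B, subset_rfl, h⟩ 0)
    rw [← this]
    exact map_map_apply χ _ (T.erase_subset hj) n _)

variable (χ) in
/-- The restriction of the iterated homotopy fibre to a face. -/
def iterFiberRestrict {C' : Finset (Fin k)} (hC : C ⊆ C') : iterFiber χ B C' ⟶ iterFiber χ B C where
  map n :=
    { toMap := ⟨fun (Φ : iterFiberSpace χ B C' n) => iterFiberMk
          (fun S => iterFiberEval Φ ⟨S.1, S.2.1, S.2.2.trans hC⟩)
          (fun _ => ContinuousMap.continuous _)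
          (fun S T => iterFiber_compat Φ ⟨S.1, S.2.1, S.2.2.trans hC⟩
            ⟨T.1, T.2.1, T.2.2.trans hC⟩)
          (fun S t _i => iterFiber_boundary Φ ⟨S.1, S.2.1, S.2.2.trans hC⟩ t),
        continuous_to_iterFiber fun S =>
          continuous_iterFiberEval (⟨S.1, S.2.1, S.2.2.trans hC⟩ : Between B C')⟩
      map_pt := rfl }
  comm _ := BasedSpace.hom_ext fun _ => loop_ext fun _ => rfl

/-- The slice `t j = u` of a point of the iterated homotopy fibre. -/
def iterFiberSlice {j : Fin k} (Φ : iterFiberSpace χ B C n) (u : I) :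
    iterFiberSpace χ (insert j B) C n :=
  iterFiberMk (fun T t => iterFiberEval Φ T.weaken (Function.update t j u))
    (fun T => (iterFiberEval Φ T.weaken).continuous.comp (continuous_id.update j continuous_const))
    (fun S T h t t' h₁ h₂ => iterFiber_compat Φ S.weaken T.weaken h _ _
      (fun i hi hi' => by
        rcases eq_or_ne i j with rfl | hij
        · simp
        · simpa [hij] using h₁ i hi (by simp [hij, hi']))
      (fun i hi hi' => by
        have hij : i ≠ j := fun hij => hi' (hij ▸ S.mem)
        simpa [hij] using h₂ i hi hi'))
    (fun S t i hi hi' h => by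
      rw [Finset.mem_insert, not_or] at hi'
      exact iterFiber_boundary Φ S.weaken _ hi hi'.2 (by simpa [hi'.1] using h))

lemma continuous_iterFiberSlice {j : Fin k} : Continuous
    fun p : iterFiberSpace χ B C n × I => iterFiberSlice (j := j) p.1 p.2 :=
  continuous_to_iterFiber fun T => (continuous_iterFiberEval T.weaken).comp
    ((continuous_fst.comp continuous_fst).prodMk
      (continuous_snd.update j (continuous_snd.comp continuous_fst)))

variable (χ) in
/-- Currying the coordinate `j` maps the iterated homotopy fibre to a homotopy fibre. -/
def iterFiberCurry {j : Fin k} (hj : j ∉ B) :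
    iterFiber χ B (insert j C) ⟶ hofiber (iterFiberEdge χ (C := C) hj) where
  map n :=
    { toMap := ⟨fun (Φ : iterFiberSpace χ B (insert j C) n) =>
          ⟨(((iterFiberRestrict χ (Finset.subset_insert j C)).map n).toMap Φ,
            ⟨iterFiberSlice Φ,
              continuous_iterFiberSlice.comp (continuous_const.prodMk continuous_id)⟩),
          -- The path starts at the edge of the restriction: passing from `T.erase j` to `T` adds
          -- only the coordinate `j`, which is `0` on this slice.
          iterFiber_ext fun T t => (iterFiber_compat Φ
            ⟨(T.erase hj).1, (T.erase hj).2.1, (T.erase hj).2.2.trans (Finset.subset_insert j C)⟩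
            T.weaken (T.erase_subset hj) t (Function.update t j 0)
            (fun i hi _ => (Function.update_of_ne ((T.mem_erase hj).1 hi).1 _ _).symm)
            (fun i hi hi' => by
              have hij : i = j := by_contra fun h => hi' ((T.mem_erase hj).2 ⟨h, hi⟩)
              simp [hij])).symm,
          iterFiber_ext fun T t =>
            iterFiber_boundary Φ T.weaken (Function.update t j 1) T.mem hj (by simp)⟩,
        Continuous.subtype_mk (Continuous.prodMk (ContinuousMap.continuous _)
          (ContinuousMap.continuous_of_continuous_uncurry _ continuous_iterFiberSlice)) _⟩
      map_pt := rfl }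
  comm _ := BasedSpace.hom_ext fun _ => loop_ext fun _ => rfl

/-- A set not containing `j`, viewed in the interval below `C`. -/
def Between.ofNotMem {j : Fin k} (S : Between B (insert j C)) (h : j ∉ S.1) : Between B C :=
  ⟨S.1, by grind⟩

/-- A set containing `j`, viewed in the interval above `B ∪ {j}`. -/
def Between.ofMem {j : Fin k} (S : Between B C) (h : j ∈ S.1) : Between (insert j B) C :=
  ⟨S.1, by grind⟩

/-- Glue a point of an iterated homotopy fibre and a path in the opposite face. -/
def iterFiberGlue {j : Fin k} (x : iterFiberSpace χ B C n)
    (γ : C(I, iterFiberSpace χ (insert j B) (insert j C) n)) (S : Between B (insert j C))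
    (t : Fin k → I) : (χ.obj S.1).space n :=
  if h : j ∈ S.1 then iterFiberEval (γ (t j)) (S.ofMem h) t
    else iterFiberEval x (S.ofNotMem h) t

section Glue

variable {j : Fin k} (x : iterFiberSpace χ B C n)
  (γ : C(I, iterFiberSpace χ (insert j B) (insert j C) n)) {S T : Between B (insert j C)}

lemma iterFiberGlue_of_mem (h : j ∈ S.1) (t : Fin k → I) :
    iterFiberGlue x γ S t = iterFiberEval (γ (t j)) (S.ofMem h) t :=
  dif_pos h

lemma iterFiberGlue_of_notMem (h : j ∉ S.1) (t : Fin k → I) :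
    iterFiberGlue x γ S t = iterFiberEval x (S.ofNotMem h) t :=
  dif_neg h

lemma continuous_iterFiberGlue (S : Between B (insert j C)) : Continuous
    fun q : (iterFiberSpace χ B C n × C(I, iterFiberSpace χ (insert j B) (insert j C) n)) ×
      (Fin k → I) => iterFiberGlue q.1.1 q.1.2 S q.2 := by
  by_cases h : j ∈ S.1
  · simp only [iterFiberGlue_of_mem _ _ h]
    refine (continuous_iterFiberEval (S.ofMem h)).comp (Continuous.prodMk ?_ continuous_snd)
    exact ContinuousEval.continuous_eval.comp ((continuous_snd.comp continuous_fst).prodMk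
      ((continuous_apply j).comp continuous_snd))
  · simp only [iterFiberGlue_of_notMem _ _ h]
    exact (continuous_iterFiberEval (S.ofNotMem h)).comp
      (Continuous.prodMk (continuous_fst.comp continuous_fst) continuous_snd)

/-- The two pieces meet only when `j ∈ T` and `j ∉ S`. Then `t' j = 0`, and the initial point of
`γ`, being the edge of `x`, supplies the compatibility; otherwise it holds inside one piece. -/
lemma iterFiberGlue_compat (hj : j ∉ B)
    (h0 : γ 0 = ((iterFiberEdge χ (C := C) hj).map n).toMap x)
    (h : S.1 ⊆ T.1) (t t' : Fin k → I)
    (h₁ : ∀ i ∈ S.1, i ∉ B → t i = t' i) (h₂ : ∀ i ∈ T.1, i ∉ S.1 → t' i = 0) :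
    ((χ.map (homOfLE h)).map n).toMap (iterFiberGlue x γ S t) = iterFiberGlue x γ T t' := by
  by_cases hS : j ∈ S.1
  · have hT : j ∈ T.1 := h hS
    rw [iterFiberGlue_of_mem _ _ hS, iterFiberGlue_of_mem _ _ hT, h₁ j hS hj]
    exact iterFiber_compat (γ (t' j)) (S.ofMem hS) (T.ofMem hT) h t t'
      (fun i hi hi' => h₁ i hi fun hB => hi' (Finset.mem_insert_of_mem hB)) h₂
  · by_cases hT : j ∈ T.1
    · rw [iterFiberGlue_of_notMem _ _ hS, iterFiberGlue_of_mem _ _ hT, h₂ j hT hS, h0]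
      change _ = ((χ.map (homOfLE ((T.ofMem hT).erase_subset hj))).map n).toMap
        (iterFiberEval x ((T.ofMem hT).erase hj) t')
      rw [← iterFiber_compat x (S.ofNotMem hS) ((T.ofMem hT).erase hj)
        (Finset.subset_erase.2 ⟨h, hS⟩) t t' h₁
        (fun i hi => h₂ i (Finset.mem_of_mem_erase hi))]
      exact (map_map_apply χ _ ((T.ofMem hT).erase_subset hj) n _).symm
    · rw [iterFiberGlue_of_notMem _ _ hS, iterFiberGlue_of_notMem _ _ hT]
      exact iterFiber_compat x (S.ofNotMem hS) (T.ofNotMem hT) h t t' h₁ h₂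

lemma iterFiberGlue_boundary
    (h1 : γ 1 = (iterFiberSpace χ (insert j B) (insert j C) n).pt)
    (t : Fin k → I) {i : Fin k} (hi : i ∈ S.1) (hi' : i ∉ B) (ht : t i = 1) :
    iterFiberGlue x γ S t = ((χ.obj S.1).space n).pt := by
  by_cases hS : j ∈ S.1
  · rw [iterFiberGlue_of_mem _ _ hS]
    by_cases hij : i = j
    · subst hij
      rw [ht, h1]
      rfl
    · exact iterFiber_boundary (γ (t j)) (S.ofMem hS) t hi (by simp [hij, hi']) ht
  · rw [iterFiberGlue_of_notMem _ _ hS]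
    exact iterFiber_boundary x (S.ofNotMem hS) t hi hi' ht

end Glue

/-- This is the exponential law. The maps with `j ∉ S` form a point of the fibre over `C`; those
with `j ∈ S`, curried in `t j`, form a path in the opposite face. The condition `t j = 1` makes the
path end at the basepoint, and gluing inverts the construction. -/
lemma isIso_iterFiberCurry {j : Fin k} (hjB : j ∉ B) (hjC : j ∉ C) :
    IsIso (iterFiberCurry χ (C := C) hjB) := by
  refine (isoOfLevelwise (iterFiberCurry χ (C := C) hjB) (fun n =>
    { toMap := ⟨fun p : BasedSpace.hofiber ((iterFiberEdge χ (C := C) hjB).map n) =>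
          iterFiberMk (iterFiberGlue p.1.1 p.1.2)
        (fun S => (continuous_iterFiberGlue S).comp (continuous_const.prodMk continuous_id))
        (fun S T => iterFiberGlue_compat _ _ hjB p.2.1)
        (fun S t _ => iterFiberGlue_boundary _ _ p.2.2 t),
        continuous_to_iterFiber fun S => (continuous_iterFiberGlue S).comp
          (((continuous_hofiber_val _).comp continuous_fst).prodMk continuous_snd)⟩
      map_pt := iterFiber_ext fun S t => ?_ }) (fun n => ?_) (fun n => ?_)).isIso_hom
  · change iterFiberGlue _ _ S t = _
    by_cases hS : j ∈ S.1
    · exact iterFiberGlue_of_mem _ _ hS t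
    · exact iterFiberGlue_of_notMem _ _ hS t
  · refine BasedSpace.hom_ext fun Φ => iterFiber_ext fun S t => ?_
    change iterFiberGlue _ _ S t = iterFiberEval Φ S t
    by_cases hS : j ∈ S.1
    · exact (iterFiberGlue_of_mem _ _ hS t).trans
        (congrArg (iterFiberEval Φ S) (Function.update_eq_self j t))
    · exact iterFiberGlue_of_notMem _ _ hS t
  · refine BasedSpace.hom_ext fun p => Subtype.ext (Prod.ext (iterFiber_ext fun S t => ?_)
      (ContinuousMap.ext fun u => iterFiber_ext fun T t => ?_))
    · exact iterFiberGlue_of_notMem p.1.1 p.1.2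
        (S := ⟨S.1, S.2.1, S.2.2.trans (Finset.subset_insert j C)⟩) (fun h => hjC (S.2.2 h)) t
    · refine (iterFiberGlue_of_mem p.1.1 p.1.2 (S := T.weaken) T.mem _).trans ?_
      rw [Function.update_self]
      -- Overwriting coordinate `j` changes nothing, since points of the opposite face do not depend
      -- on it.
      refine iterFiber_congr (χ := χ) (p.1.2 u) T fun i _ hi => ?_
      rw [Function.update_of_ne (by grind)]

end Cube
/-! ### The cube as a cone on a simplex -/

section Cone

variable {ι : Type*} [Fintype ι]

lemma stdSimplex_norm_pos (p : stdSimplex ℝ ι) : 0 < ‖(p : ι → ℝ)‖ := by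
  refine norm_pos_iff.2 fun h => ?_
  have := stdSimplex.sum_eq_one p
  rw [h] at this
  simp at this

lemma stdSimplex_le_norm (p : stdSimplex ℝ ι) (i : ι) : p i ≤ ‖(p : ι → ℝ)‖ :=
  (le_abs_self _).trans (norm_le_pi_norm (p : ι → ℝ) i)

/-- The point of the cube at distance `u` from the origin (in the supremum norm) in the direction
of a point of the simplex. -/
noncomputable def radial (u : I) (p : stdSimplex ℝ ι) : ι → I := fun i =>
  ⟨u * (p i / ‖(p : ι → ℝ)‖), unitInterval.mul_mem u.2
    ⟨div_nonneg (stdSimplex.zero_le p i) (norm_nonneg _),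
      div_le_one_of_le₀ (stdSimplex_le_norm p i) (norm_nonneg _)⟩⟩

lemma continuous_radial : Continuous fun q : I × stdSimplex ℝ ι => radial q.1 q.2 := by
  have h : Continuous fun q : I × stdSimplex ℝ ι => (q.2 : ι → ℝ) :=
    continuous_subtype_val.comp continuous_snd
  exact continuous_pi fun i => Continuous.subtype_mk
    ((continuous_subtype_val.comp continuous_fst).mul
      (((continuous_apply i).comp h).div h.norm fun q => (stdSimplex_norm_pos q.2).ne')) _

@[simp] lemma radial_zero (p : stdSimplex ℝ ι) (i : ι) : radial 0 p i = 0 :=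
  Subtype.ext (by simp [radial])

lemma exists_stdSimplex_eq_norm (p : stdSimplex ℝ ι) : ∃ i, p i = ‖(p : ι → ℝ)‖ := by
  have : Nonempty ι := by
    by_contra h
    have := not_nonempty_iff.1 h
    simpa using stdSimplex.sum_eq_one p
  obtain ⟨i, hi⟩ := Finite.exists_max (p : ι → ℝ)
  refine ⟨i, (stdSimplex_le_norm p i).antisymm
    ((pi_norm_le_iff_of_nonneg (stdSimplex.zero_le p i)).2 fun j => ?_)⟩
  rw [Real.norm_of_nonneg (stdSimplex.zero_le p j)]
  exact hi j

lemma exists_radial_eq (u : I) (p : stdSimplex ℝ ι) : ∃ i, radial u p i = u := by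
  obtain ⟨i, hi⟩ := exists_stdSimplex_eq_norm p
  exact ⟨i, Subtype.ext (by simp [radial, hi, (stdSimplex_norm_pos p).ne'])⟩

lemma radial_le (u : I) (p : stdSimplex ℝ ι) (i : ι) : radial u p i ≤ u :=
  Subtype.coe_le_coe.1 (mul_le_of_le_one_right u.2.1
    (div_le_one_of_le₀ (stdSimplex_le_norm p i) (norm_nonneg _)))

/-- The supremum norm of a point of the cube. -/
noncomputable def cubeNorm (t : ι → I) : I := Finset.univ.sup t

@[simp] lemma cubeNorm_radial (u : I) (p : stdSimplex ℝ ι) : cubeNorm (radial u p) = u := by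
  refine le_antisymm (Finset.sup_le fun i _ => radial_le u p i) ?_
  obtain ⟨i, hi⟩ := exists_radial_eq u p
  exact hi.ge.trans (Finset.le_sup (f := radial u p) (Finset.mem_univ i))

open Classical in
/-- The direction of a point of the cube, as a point of the simplex. -/
noncomputable def cubeDirection [Nonempty ι] (t : ι → I) : stdSimplex ℝ ι :=
  -- The origin has no direction; an arbitrary vertex serves as default.
  if h : ∑ i, (t i : ℝ) = 0 then ⟨_, single_mem_stdSimplex ℝ (Classical.arbitrary ι)⟩
  else ⟨fun i => t i / ∑ i, (t i : ℝ), fun i => div_nonneg (t i).2.1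
    (Finset.sum_nonneg fun i _ => (t i).2.1), by rw [← Finset.sum_div, div_self h]⟩

/-- Rescaling to coordinate sum `1` undoes rescaling to supremum norm `u`, as both stay on the same
ray. -/
lemma cubeDirection_radial [Nonempty ι] {u : I} (hu : u ≠ 0) (p : stdSimplex ℝ ι) :
    cubeDirection (radial u p) = p := by
  have hu' : (u : ℝ) ≠ 0 := fun h => hu (Subtype.ext h)
  have hp := (stdSimplex_norm_pos p).ne'
  have hs : ∑ i, (radial u p i : ℝ) = u / ‖(p : ι → ℝ)‖ := by
    simp only [radial, ← Finset.mul_sum, ← Finset.sum_div, stdSimplex.sum_eq_one, mul_one_div]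
  rw [cubeDirection, dif_neg (by rw [hs]; exact div_ne_zero hu' hp)]
  refine stdSimplex.ext (funext fun i => ?_)
  change (radial u p i : ℝ) / ∑ i, (radial u p i : ℝ) = p i
  rw [hs]
  simp only [radial]
  field_simp

lemma exists_eq_radial [Nonempty ι] (t : ι → I) : ∃ u p, t = radial u p := by
  by_cases h : ∑ i, (t i : ℝ) = 0
  · refine ⟨0, cubeDirection t, funext fun i => Subtype.ext ?_⟩
    rw [radial_zero]
    exact (Finset.sum_eq_zero_iff_of_nonneg fun i _ => (t i).2.1).1 h i (Finset.mem_univ i)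
  · set s := ∑ i, (t i : ℝ)
    have hs : 0 < s := lt_of_le_of_ne (Finset.sum_nonneg fun i _ => (t i).2.1) (Ne.symm h)
    let p : stdSimplex ℝ ι := ⟨fun i => t i / s, fun i => div_nonneg (t i).2.1 hs.le, by
      rw [← Finset.sum_div, div_self h]⟩
    have hp (i) : p i = t i / s := rfl
    obtain ⟨j, hj⟩ := exists_stdSimplex_eq_norm p
    refine ⟨t j, p, funext fun i => Subtype.ext ?_⟩
    have htj : (t j : ℝ) ≠ 0 := fun h0 => (stdSimplex_norm_pos p).ne'
      (by rw [← hj, hp, h0, zero_div])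
    simp only [radial, ← hj, hp]
    field_simp

/-- A product of a quotient map with a space `X` need not be a quotient map, but `radial` goes from
a compact to a Hausdorff space, hence is proper, and properness survives products. The lemma yields
continuity at the cone point, where `cubeDirection` is of no use. -/
lemma isQuotientMap_radial [Nonempty ι] (X : Type*) [TopologicalSpace X] :
    Topology.IsQuotientMap fun q : X × (I × stdSimplex ℝ ι) => (q.1, radial q.2.1 q.2.2) := by
  have h : IsProperMap (Prod.map id (fun q : I × stdSimplex ℝ ι => radial q.1 q.2) :
      X × (I × stdSimplex ℝ ι) → X × (ι → I)) :=
    IsProperMap.prodMap (Homeomorph.refl X).isProperMap continuous_radial.isProperMap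
  refine h.isClosedMap.isQuotientMap h.continuous fun q => ?_
  obtain ⟨u, p, hq⟩ := exists_eq_radial q.2
  exact ⟨(q.1, u, p), Prod.ext rfl hq.symm⟩

end Cone

/-! ### Compatibility of radial coordinates with faces -/

section Face

variable {k : ℕ} {S T : Finset (Fin k)}

/-- Extension of a point of the cube `I^S` by zero. -/
def extendZero (t : S → I) : Fin k → I := fun i => if h : i ∈ S then t ⟨i, h⟩ else 0

lemma extendZero_of_mem (t : S → I) {i : Fin k} (h : i ∈ S) : extendZero t i = t ⟨i, h⟩ := dif_pos h

lemma extendZero_of_notMem (t : S → I) {i : Fin k} (h : i ∉ S) : extendZero t i = 0 := dif_neg h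

lemma continuous_extendZero : Continuous (extendZero : (S → I) → Fin k → I) := by
  refine continuous_pi fun i => ?_
  by_cases h : i ∈ S
  · simp only [extendZero_of_mem _ h]
    exact continuous_apply _
  · simp only [extendZero_of_notMem _ h]
    exact continuous_const

lemma face_apply (h : S ⊆ T) (p : stdSimplex ℝ S) (i : T) :
    face h p i = if hi : i.1 ∈ S then p ⟨i, hi⟩ else 0 := by
  change stdSimplex.map _ p i = _
  rw [stdSimplex.map_coe, FunOnFinite.linearMap_apply_apply]
  split_ifs with hi
  · rw [Finset.sum_eq_single_of_mem (⟨i, hi⟩ : S) (by simp [Set.inclusion])]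
    intro b hb hb'
    refine absurd (Subtype.ext ?_) hb'
    simpa [Set.inclusion, Subtype.ext_iff] using hb
  · refine Finset.sum_eq_zero fun b hb => absurd ?_ hi
    have : b.1 = i.1 := by simpa [Set.inclusion, Subtype.ext_iff] using hb
    exact this ▸ b.2

/-- A face inclusion extends by zero, which preserves the supremum norm. Radial coordinates are
therefore compatible with faces. -/
lemma norm_face (h : S ⊆ T) (p : stdSimplex ℝ S) :
    ‖(face h p : T → ℝ)‖ = ‖(p : S → ℝ)‖ := by
  refine le_antisymm ((pi_norm_le_iff_of_nonneg (norm_nonneg _)).2 fun i => ?_)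
    ((pi_norm_le_iff_of_nonneg (norm_nonneg _)).2 fun i => ?_)
  · rw [face_apply]
    split_ifs with hi
    · exact norm_le_pi_norm (p : S → ℝ) _
    · simp
  · have := norm_le_pi_norm (face h p : T → ℝ) ⟨i, h i.2⟩
    rwa [face_apply, dif_pos i.2] at this

lemma radial_face_of_mem (h : S ⊆ T) (u : I) (p : stdSimplex ℝ S) (i : T) (hi : i.1 ∈ S) :
    radial u (face h p) i = radial u p ⟨i, hi⟩ :=
  Subtype.ext (by simp only [radial, norm_face, face_apply, hi, dite_true])

lemma radial_face_of_notMem (h : S ⊆ T) (u : I) (p : stdSimplex ℝ S) (i : T) (hi : i.1 ∉ S) :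
    radial u (face h p) i = 0 :=
  Subtype.ext (by simp [radial, face_apply, hi])

lemma extendZero_radial_face (h : S ⊆ T) (u : I) (p : stdSimplex ℝ S) :
    extendZero (radial u (face h p)) = extendZero (radial u p) := by
  funext i
  by_cases hi : i ∈ S
  · rw [extendZero_of_mem _ hi, extendZero_of_mem _ (h hi), radial_face_of_mem _ _ _ _ hi]
  · rw [extendZero_of_notMem _ hi]
    by_cases hi' : i ∈ T
    · rw [extendZero_of_mem _ hi', radial_face_of_notMem _ _ _ _ hi]
    · rw [extendZero_of_notMem _ hi']

end Face
-- Comparison of the iterated and the total homotopy fibre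
namespace Cube

variable {k : ℕ} {χ : Cube k Spectrum.{u}} {n : ℕ}

/-- A subset of the `k`-element set, viewed between the extreme ones. -/
abbrev Between.all (S : Finset (Fin k)) : Between ∅ (Finset.univ : Finset (Fin k)) :=
  ⟨S, Finset.empty_subset S, Finset.subset_univ S⟩

/-- Evaluation of a point of the punctured homotopy limit. -/
def holimEval (Ψ : puncturedHolimSpace χ n) (S : NonemptySubset k) :
    C(stdSimplex ℝ S.1, (χ.obj S.1).space n) :=
  (show {_Ψ : ∀ S : NonemptySubset k, C(stdSimplex ℝ S.1, (χ.obj S.1).space n) // _} from Ψ).1 S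

lemma holim_ext {Φ Ψ : puncturedHolimSpace χ n}
    (h : ∀ S p, holimEval Φ S p = holimEval Ψ S p) : Φ = Ψ :=
  Subtype.ext (funext fun S => ContinuousMap.ext (h S))

lemma holim_compat (Ψ : puncturedHolimSpace χ n) (S T : NonemptySubset k) (h : S.1 ⊆ T.1)
    (p : stdSimplex ℝ S.1) :
    ((χ.map (homOfLE h)).map n).toMap (holimEval Ψ S p) = holimEval Ψ T (face h p) :=
  Ψ.2 S T h p

lemma continuous_holimEval (S : NonemptySubset k) : Continuous
    fun q : puncturedHolimSpace χ n × stdSimplex ℝ S.1 => holimEval q.1 S q.2 :=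
  ContinuousEval.continuous_eval.comp (((continuous_apply S).comp
    (continuous_subtype_val.comp continuous_fst)).prodMk continuous_snd)

lemma continuous_to_holim {X : Type*} [TopologicalSpace X] {F : X → puncturedHolimSpace χ n}
    (h : ∀ S, Continuous fun q : X × stdSimplex ℝ S.1 => holimEval (F q.1) S q.2) :
    Continuous F :=
  continuous_induced_rng.2 (continuous_pi fun S =>
    ContinuousMap.continuous_of_continuous_uncurry _ (h S))

/-- Build a point of the punctured homotopy limit. -/
def holimMk (Ψ : ∀ S : NonemptySubset k, C(stdSimplex ℝ S.1, (χ.obj S.1).space n))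
    (h : ∀ (S T : NonemptySubset k) (h : S.1 ⊆ T.1) (p : stdSimplex ℝ S.1),
      ((χ.map (homOfLE h)).map n).toMap (Ψ S p) = Ψ T (face h p)) : puncturedHolimSpace χ n :=
  ⟨Ψ, h⟩

/-- The restriction of a point of the iterated homotopy fibre to the simplices at distance `u`
from the origin. -/
noncomputable def radialRestrict (Φ : iterFiberSpace χ ∅ Finset.univ n) (u : I) :
    puncturedHolimSpace χ n :=
  holimMk (fun S => ⟨fun p => iterFiberEval Φ (.all S.1) (extendZero (radial u p)),
      (iterFiberEval Φ (.all S.1)).continuous.comp (continuous_extendZero.comp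
        (continuous_radial.comp (continuous_const.prodMk continuous_id)))⟩)
    (fun S T h p => iterFiber_compat Φ (.all S.1) (.all T.1) h _ _
      (fun i _ _ => by rw [extendZero_radial_face])
      (fun i _ hi => by rw [extendZero_radial_face, extendZero_of_notMem _ hi]))

lemma continuous_radialRestrict : Continuous
    fun q : iterFiberSpace χ ∅ Finset.univ n × I => radialRestrict q.1 q.2 :=
  continuous_to_holim fun S => (continuous_iterFiberEval (.all S.1)).comp
    ((continuous_fst.comp continuous_fst).prodMk (continuous_extendZero.comp
      (continuous_radial.comp ((continuous_snd.comp continuous_fst).prodMk continuous_snd))))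

lemma radialRestrict_zero (Φ : iterFiberSpace χ ∅ Finset.univ n) :
    radialRestrict Φ 0 =
      ((toPuncturedHolim χ).map n).toMap (iterFiberEval Φ (.all ∅) 0) :=
  holim_ext fun S p => (iterFiber_compat Φ (.all ∅) (.all S.1) (Finset.empty_subset S.1) 0 _
    (fun i hi => absurd hi (Finset.notMem_empty i))
    (fun i hi _ => (extendZero_of_mem _ hi).trans (radial_zero p ⟨i, hi⟩))).symm

lemma radialRestrict_one (Φ : iterFiberSpace χ ∅ Finset.univ n) :
    radialRestrict Φ 1 = (puncturedHolimSpace χ n).pt :=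
  holim_ext fun S p => by
    obtain ⟨i, hi⟩ := exists_radial_eq 1 p
    exact iterFiber_boundary Φ (.all S.1) _ i.2 (Finset.notMem_empty i.1)
      ((extendZero_of_mem _ i.2).trans hi)

variable (χ) in
/-- The comparison map from the iterated homotopy fibre to the total homotopy fibre. -/
noncomputable def iterFiberToTfiber : iterFiber χ ∅ Finset.univ ⟶ tfiber χ where
  map n :=
    { toMap := ⟨fun Φ : iterFiberSpace χ ∅ Finset.univ n =>
          ⟨(iterFiberEval Φ (.all ∅) 0, ⟨radialRestrict Φ,
            continuous_radialRestrict.comp (continuous_const.prodMk continuous_id)⟩),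
            radialRestrict_zero Φ, radialRestrict_one Φ⟩,
        Continuous.subtype_mk (Continuous.prodMk
          ((continuous_iterFiberEval (.all ∅)).comp (continuous_id.prodMk continuous_const))
          (ContinuousMap.continuous_of_continuous_uncurry _ continuous_radialRestrict)) _⟩
      map_pt := rfl }
  comm _ := BasedSpace.hom_ext fun _ => loop_ext fun _ => rfl

lemma iterFiberToTfiber_ι : iterFiberToTfiber χ ≫ tfiberι χ =
    iterFiberι χ (Finset.empty_subset Finset.univ) :=
  rfl

/-- The map on the cube `I^S` determined by a path in the punctured homotopy limit. -/
noncomputable def radialExtend (γ : C(I, puncturedHolimSpace χ n)) (S : NonemptySubset k)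
    (t : S.1 → I) : (χ.obj S.1).space n :=
  have := S.2.to_subtype
  holimEval (γ (cubeNorm t)) S (cubeDirection t)

section Extend

variable {x : (χ.obj ∅).space n} {γ : C(I, puncturedHolimSpace χ n)}

/-- Away from the origin radial coordinates are unique. At the origin `γ 0` consists of constant
maps, so the default direction is harmless. -/
lemma radialExtend_radial (h0 : γ 0 = ((toPuncturedHolim χ).map n).toMap x)
    (S : NonemptySubset k) (u : I) (p : stdSimplex ℝ S.1) :
    radialExtend γ S (radial u p) = holimEval (γ u) S p := by
  have := S.2.to_subtype
  rw [radialExtend, cubeNorm_radial]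
  by_cases hu : u = 0
  · rw [hu, h0]
    rfl
  · rw [cubeDirection_radial hu]

/-- Continuity is tested after pulling back to radial coordinates, where the map is evaluation of
`γ`. -/
lemma continuous_radialExtend (S : NonemptySubset k) : Continuous
    fun q : BasedSpace.hofiber ((toPuncturedHolim χ).map n) × (S.1 → I) =>
      radialExtend q.1.1.2 S q.2 := by
  have := S.2.to_subtype
  refine (isQuotientMap_radial
    (BasedSpace.hofiber ((toPuncturedHolim χ).map n))).continuous_iff.2 ?_
  have : (fun q : BasedSpace.hofiber ((toPuncturedHolim χ).map n) × (S.1 → I) =>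
        radialExtend q.1.1.2 S q.2) ∘ (fun q : _ × (I × stdSimplex ℝ S.1) =>
          (q.1, radial q.2.1 q.2.2)) = fun q => holimEval (q.1.1.2 q.2.1) S q.2.2 :=
    funext fun q => radialExtend_radial q.1.2.1 S q.2.1 q.2.2
  rw [this]
  refine (continuous_holimEval S).comp (Continuous.prodMk ?_ (continuous_snd.comp continuous_snd))
  exact ContinuousEval.continuous_eval.comp ((continuous_snd.comp
    ((continuous_hofiber_val _).comp continuous_fst)).prodMk (continuous_fst.comp continuous_snd))

/-- The family of maps on cubes determined by a point of the total homotopy fibre. -/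
noncomputable def conicalExtend (x : (χ.obj ∅).space n) (γ : C(I, puncturedHolimSpace χ n))
    (S : Between ∅ (Finset.univ : Finset (Fin k))) (t : Fin k → I) : (χ.obj S.1).space n :=
  if h : S.1.Nonempty then radialExtend γ ⟨S.1, h⟩ fun i => t i
    else ((χ.map (homOfLE (Finset.empty_subset S.1))).map n).toMap x

lemma conicalExtend_nonempty {S : Between ∅ (Finset.univ : Finset (Fin k))} (h : S.1.Nonempty)
    (t : Fin k → I) : conicalExtend x γ S t = radialExtend γ ⟨S.1, h⟩ fun i => t i :=
  dif_pos h

lemma conicalExtend_empty {S : Between ∅ (Finset.univ : Finset (Fin k))} (h : ¬ S.1.Nonempty)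
    (t : Fin k → I) :
    conicalExtend x γ S t = ((χ.map (homOfLE (Finset.empty_subset S.1))).map n).toMap x :=
  dif_neg h

lemma conicalExtend_radial (h0 : γ 0 = ((toPuncturedHolim χ).map n).toMap x)
    {S : Between ∅ (Finset.univ : Finset (Fin k))} (h : S.1.Nonempty) {t : Fin k → I} {u : I}
    {p : stdSimplex ℝ S.1} (ht : ∀ i : S.1, t i = radial u p i) :
    conicalExtend x γ S t = holimEval (γ u) ⟨S.1, h⟩ p := by
  rw [conicalExtend_nonempty h, ← radialExtend_radial h0 ⟨S.1, h⟩]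
  exact congrArg _ (funext ht)

lemma conicalExtend_compat (h0 : γ 0 = ((toPuncturedHolim χ).map n).toMap x)
    {S T : Between ∅ (Finset.univ : Finset (Fin k))} (h : S.1 ⊆ T.1) (t t' : Fin k → I)
    (h₁ : ∀ i ∈ S.1, i ∉ (∅ : Finset (Fin k)) → t i = t' i)
    (h₂ : ∀ i ∈ T.1, i ∉ S.1 → t' i = 0) :
    ((χ.map (homOfLE h)).map n).toMap (conicalExtend x γ S t) = conicalExtend x γ T t' := by
  by_cases hT : T.1.Nonempty
  · by_cases hS : S.1.Nonempty
    · have := hS.to_subtype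
      obtain ⟨u, p, ht⟩ := exists_eq_radial fun i : S.1 => t i
      -- On `T` the point `t'` extends `t` by zero, so it has the same radius and direction `face h
      -- p`.
      rw [conicalExtend_radial h0 hS (congrFun ht), conicalExtend_radial h0 hT (p := face h p)
        (u := u)]
      · exact holim_compat (γ u) ⟨S.1, hS⟩ ⟨T.1, hT⟩ h p
      · intro i
        by_cases hi : i.1 ∈ S.1
        · rw [radial_face_of_mem _ _ _ _ hi, ← h₁ _ hi (Finset.notMem_empty _)]
          exact congrFun ht ⟨i, hi⟩
        · rw [radial_face_of_notMem _ _ _ _ hi, h₂ _ i.2 hi]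
    -- With `S` empty, `t'` vanishes on `T`: it is the cone point, and any direction may represent
    -- it.
    · have := hT.to_subtype
      rw [conicalExtend_empty hS, map_map_apply,
        conicalExtend_radial h0 hT (u := 0) (p := cubeDirection 0), h0]
      · rfl
      · intro i
        rw [radial_zero, h₂ _ i.2 fun hi => hS ⟨_, hi⟩]
  · have hS : ¬ S.1.Nonempty := fun hS => hT (hS.mono h)
    rw [conicalExtend_empty hS, conicalExtend_empty hT, map_map_apply]

lemma conicalExtend_boundary (h0 : γ 0 = ((toPuncturedHolim χ).map n).toMap x)
    (h1 : γ 1 = (puncturedHolimSpace χ n).pt)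
    {S : Between ∅ (Finset.univ : Finset (Fin k))} (t : Fin k → I) {i : Fin k} (hi : i ∈ S.1)
    (hti : t i = 1) : conicalExtend x γ S t = ((χ.obj S.1).space n).pt := by
  have hS : S.1.Nonempty := ⟨i, hi⟩
  have := hS.to_subtype
  obtain ⟨u, p, ht⟩ := exists_eq_radial fun i : S.1 => t i
  -- No coordinate exceeds the radius, so a coordinate equal to `1` forces radius `1`, the end of
  -- the path.
  have hu : u = 1 := le_antisymm unitInterval.le_one' (by
    rw [← hti, congrFun ht ⟨i, hi⟩]
    exact radial_le u p _)
  rw [conicalExtend_radial h0 hS (congrFun ht), hu, h1]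
  rfl

lemma continuous_conicalExtend (S : Between ∅ (Finset.univ : Finset (Fin k))) : Continuous
    fun q : BasedSpace.hofiber ((toPuncturedHolim χ).map n) × (Fin k → I) =>
      conicalExtend q.1.1.1 q.1.1.2 S q.2 := by
  by_cases hS : S.1.Nonempty
  · refine Continuous.congr ?_ fun q => (conicalExtend_nonempty hS q.2).symm
    exact (continuous_radialExtend ⟨S.1, hS⟩).comp (continuous_fst.prodMk
      (continuous_pi fun i => (continuous_apply i.1).comp continuous_snd))
  · refine Continuous.congr ?_ fun q => (conicalExtend_empty hS q.2).symm
    exact ((χ.map (homOfLE (Finset.empty_subset S.1))).map n).toMap.continuous.comp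
      (continuous_fst.comp ((continuous_hofiber_val _).comp continuous_fst))

end Extend

variable (χ) in
/-- The total homotopy fibre is isomorphic to the iterated homotopy fibre. -/
lemma isIso_iterFiberToTfiber : IsIso (iterFiberToTfiber χ) := by
  refine (isoOfLevelwise (iterFiberToTfiber χ) (fun n =>
    { toMap := ⟨fun p : BasedSpace.hofiber ((toPuncturedHolim χ).map n) =>
          iterFiberMk (conicalExtend p.1.1 p.1.2)
            (fun S => (continuous_conicalExtend S).comp (continuous_const.prodMk continuous_id))
            (fun S T => conicalExtend_compat p.2.1)
            (fun S t i hi _ => conicalExtend_boundary p.2.1 p.2.2 t hi),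
        continuous_to_iterFiber continuous_conicalExtend⟩
      map_pt := iterFiber_ext fun S t => ?_ }) (fun n => ?_) (fun n => ?_)).isIso_hom
  · by_cases hS : S.1.Nonempty
    · exact conicalExtend_nonempty hS t
    · exact (conicalExtend_empty hS t).trans
        ((χ.map (homOfLE (Finset.empty_subset S.1))).map n).map_pt
  · refine BasedSpace.hom_ext fun Φ => iterFiber_ext fun S t => ?_
    by_cases hS : S.1.Nonempty
    · have := hS.to_subtype
      obtain ⟨u, p, ht⟩ := exists_eq_radial fun i : S.1 => t i
      refine (conicalExtend_radial (radialRestrict_zero Φ) hS (congrFun ht)).trans ?_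
      exact iterFiber_congr (χ := χ) Φ S fun i hi _ =>
        (extendZero_of_mem _ hi).trans (congrFun ht ⟨i, hi⟩).symm
    · refine (conicalExtend_empty hS t).trans ?_
      exact iterFiber_compat Φ (.all ∅) S (Finset.empty_subset S.1) 0 t
        (fun i hi => absurd hi (Finset.notMem_empty i)) (fun i hi => absurd ⟨i, hi⟩ hS)
  · refine BasedSpace.hom_ext fun q => Subtype.ext (Prod.ext ?_
      (ContinuousMap.ext fun u => holim_ext fun S p => ?_))
    · exact (conicalExtend_empty (γ := q.1.2) (S := .all ∅) Finset.not_nonempty_empty 0).trans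
        (map_self_apply χ _ n _)
    · exact conicalExtend_radial (S := .all S.1) q.2.1 S.2 fun i => extendZero_of_mem _ i.2

end Cube
/-! ### Split subobjects and quotients of abelian groups -/

/-- The homomorphism `a` is a split injection with image `K`. -/
def IsSplitInjOnto {G M : Type*} [AddCommGroup G] [AddCommGroup M] (a : G →+ M)
    (K : AddSubgroup M) : Prop :=
  (∃ r : M →+ G, ∀ x, r (a x) = x) ∧ a.range = K

/-- The homomorphism `a` is a split surjection with kernel `K`. -/
def IsSplitSurjMod {M G : Type*} [AddCommGroup G] [AddCommGroup M] (a : M →+ G)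
    (K : AddSubgroup M) : Prop :=
  (∃ r : G →+ M, ∀ x, a (r x) = x) ∧ a.ker = K

section Algebra

variable {H X Y M N : Type*} [AddCommGroup H] [AddCommGroup X] [AddCommGroup Y] [AddCommGroup M]
  [AddCommGroup N]

/-- Regard `X` and `Y` as the summands `K` and `L`, and `f` as the restriction of `e`. Then `s ∘
g⁻¹` is a section of `e` carrying `L` into `K`, because `g⁻¹` preserves `L`; it restricts to a
section of `f`. -/
lemma exists_section_of_section_ambient {f : X →+ Y} {a : X →+ M} {b : Y →+ N} {e : M →+ N}
    {s : N →+ M} {K : AddSubgroup M} {L : AddSubgroup N} (ha : IsSplitInjOnto a K)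
    (hb : IsSplitInjOnto b L) (hf : ∀ x, b (f x) = e (a x)) (g : N ≃+ N)
    (hg : ∀ y, g y = e (s y)) (hs : ∀ y ∈ L, s y ∈ K) (hL : ∀ y, g y ∈ L → y ∈ L) :
    ∃ c : Y →+ X, ∀ y, f (c y) = y := by
  obtain ⟨⟨r, hr⟩, ha⟩ := ha
  obtain ⟨⟨q, hq⟩, hb⟩ := hb
  refine ⟨r.comp (s.comp (g.symm.toAddMonoidHom.comp b)), fun y => ?_⟩
  have h1 : g.symm (b y) ∈ L := hL _ (by rw [g.apply_symm_apply, ← hb]; exact ⟨y, rfl⟩)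
  have h2 := hs _ h1
  rw [← ha] at h2
  obtain ⟨x, hx⟩ := h2
  change f (r (s (g.symm (b y)))) = y
  rw [← hx, hr, ← hq (f x), hf, hx, ← hg, g.apply_symm_apply, hq]

/-- The map `id - c ∘ f` projects `X` onto `ker f = H`, so `H` is a summand of a summand.
Injectivity of `b` turns `f x = 0` into `e (a x) = 0`, which gives the image. -/
lemma isSplitInjOnto_ker {ι : H →+ X} {f : X →+ Y} {a : X →+ M} {b : Y →+ N} {e : M →+ N}
    {K : AddSubgroup M} {L : AddSubgroup N} (ha : IsSplitInjOnto a K)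
    (hb : IsSplitInjOnto b L) (hf : ∀ x, b (f x) = e (a x)) (hι : Function.Injective ι)
    (hex : Function.Exact ι f) {c : Y →+ X} (hc : ∀ y, f (c y) = y) :
    IsSplitInjOnto (a.comp ι) (K ⊓ e.ker) := by
  obtain ⟨⟨r, hr⟩, ha⟩ := ha
  obtain ⟨⟨q, hq⟩, hb⟩ := hb
  have hmem (x : X) : x - c (f x) ∈ ι.range := (hex _).1 (by rw [map_sub, hc, sub_self])
  let ρ : X →+ H := (AddMonoidHom.ofInjective hι).symm.toAddMonoidHom.comp
    ((AddMonoidHom.id X - c.comp f).codRestrict ι.range hmem)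
  have hρ (h : H) : ρ (ι h) = h := by
    refine (AddMonoidHom.ofInjective hι).symm_apply_eq.2 (Subtype.ext ?_)
    change ι h - c (f (ι h)) = ι h
    rw [(hex _).2 ⟨h, rfl⟩, map_zero, sub_zero]
  refine ⟨⟨ρ.comp r, fun x => ?_⟩, ?_⟩
  · change ρ (r (a (ι x))) = x
    rw [hr, hρ]
  · ext m
    rw [AddSubgroup.mem_inf, ← ha, AddMonoidHom.mem_ker]
    constructor
    · rintro ⟨h, rfl⟩
      refine ⟨⟨ι h, rfl⟩, ?_⟩
      change e (a (ι h)) = 0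
      rw [← hf, (hex _).2 ⟨h, rfl⟩, map_zero]
    · rintro ⟨⟨x, rfl⟩, hx⟩
      obtain ⟨h, rfl⟩ := (hex x).1 (by rw [← hq (f x), hf, hx, map_zero])
      exact ⟨h, rfl⟩

/-- Dually, `X = M / K` and `Y = N / L`, and `g⁻¹ ∘ s` descends to these quotients. -/
lemma exists_retraction_of_retraction_ambient {f : Y →+ X} {a : M →+ X} {b : N →+ Y}
    {e : N →+ M} {s : M →+ N} {K : AddSubgroup M} {L : AddSubgroup N} (ha : IsSplitSurjMod a K)
    (hb : IsSplitSurjMod b L) (hf : ∀ y, f (b y) = a (e y)) (g : N ≃+ N)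
    (hg : ∀ y, g y = s (e y)) (hs : ∀ m ∈ K, s m ∈ L) (hL : ∀ y, g y ∈ L → y ∈ L) :
    ∃ c : X →+ Y, ∀ y, c (f y) = y := by
  obtain ⟨⟨r, hr⟩, ha⟩ := ha
  obtain ⟨⟨q, hq⟩, hb⟩ := hb
  refine ⟨b.comp (g.symm.toAddMonoidHom.comp (s.comp r)), fun y => ?_⟩
  obtain ⟨y, rfl⟩ : ∃ z, b z = y := ⟨q y, hq y⟩
  change b (g.symm (s (r (f (b y))))) = b y
  -- The lift `r` inverts `a` only modulo `K`; the error is carried into `L` by `s` and kept there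
  -- by `g⁻¹`.
  have h1 : r (a (e y)) - e y ∈ K := by
    rw [← ha, AddMonoidHom.mem_ker, map_sub, hr, sub_self]
  have h2 : g.symm (s (r (a (e y)))) - y ∈ L := hL _ (by
    rw [map_sub, g.apply_symm_apply, hg, ← map_sub]
    exact hs _ h1)
  rwa [← hb, AddMonoidHom.mem_ker, map_sub, sub_eq_zero, ← hf] at h2

/-- The map `id - f ∘ c` kills the image of `f`, hence descends to a section `X / im f = H → X` of
`ι`. -/
lemma isSplitSurjMod_coker {ι : X →+ H} {f : Y →+ X} {a : M →+ X} {b : N →+ Y} {e : N →+ M}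
    {K : AddSubgroup M} {L : AddSubgroup N} (ha : IsSplitSurjMod a K)
    (hb : IsSplitSurjMod b L) (hf : ∀ y, f (b y) = a (e y)) (hι : Function.Surjective ι)
    (hex : Function.Exact f ι) {c : X →+ Y} (hc : ∀ y, c (f y) = y) :
    IsSplitSurjMod (ι.comp a) (K ⊔ e.range) := by
  obtain ⟨⟨r, hr⟩, ha⟩ := ha
  obtain ⟨⟨q, hq⟩, hb⟩ := hb
  let p : X →+ X := AddMonoidHom.id X - f.comp c
  have hp (x : X) : p x = x - f (c x) := rfl
  have hιp (x : X) : ι (p x) = ι x := by rw [hp, map_sub, (hex _).2 ⟨_, rfl⟩, sub_zero]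
  have hpι (x : X) (h : ι x = 0) : p x = 0 := by
    obtain ⟨y, rfl⟩ := (hex x).1 h
    rw [hp, hc, sub_self]
  let τ : H →+ X := (QuotientAddGroup.lift ι.ker p hpι).comp
    (QuotientAddGroup.quotientKerEquivOfSurjective ι hι).symm.toAddMonoidHom
  have hτ (x : X) : τ (ι x) = p x := by
    have : (QuotientAddGroup.quotientKerEquivOfSurjective ι hι).symm (ι x) =
        (x : X ⧸ ι.ker) := (AddEquiv.symm_apply_eq _).2 rfl
    change QuotientAddGroup.lift ι.ker p hpι
      ((QuotientAddGroup.quotientKerEquivOfSurjective ι hι).symm (ι x)) = _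
    rw [this]
    rfl
  refine ⟨⟨r.comp τ, fun h => ?_⟩, ?_⟩
  · obtain ⟨x, rfl⟩ := hι h
    change ι (a (r (τ (ι x)))) = ι x
    rw [hr, hτ, hιp]
  · refine le_antisymm (fun m hm => ?_) (sup_le (fun m hm => ?_) ?_)
    · obtain ⟨y, hy⟩ := (hex (a m)).1 hm
      obtain ⟨z, rfl⟩ : ∃ z, b z = y := ⟨q y, hq y⟩
      rw [hf] at hy
      rw [← sub_add_cancel m (e z)]
      refine AddSubgroup.add_mem_sup ?_ ⟨z, rfl⟩
      rw [← ha, AddMonoidHom.mem_ker, map_sub, hy, sub_self]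
    · rw [← ha, AddMonoidHom.mem_ker] at hm
      change ι (a m) = 0
      rw [hm, map_zero]
    · rintro _ ⟨z, rfl⟩
      change ι (a (e z)) = 0
      rw [← hf]
      exact (hex _).2 ⟨_, rfl⟩

lemma IsSplitInjOnto.comp_addEquiv {a : X →+ M} {K : AddSubgroup M} (ha : IsSplitInjOnto a K)
    (e : H ≃+ X) : IsSplitInjOnto (a.comp e.toAddMonoidHom) K := by
  obtain ⟨⟨r, hr⟩, ha⟩ := ha
  refine ⟨⟨e.symm.toAddMonoidHom.comp r, fun x => ?_⟩, ?_⟩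
  · change e.symm (r (a (e x))) = x
    rw [hr, e.symm_apply_apply]
  · rw [AddMonoidHom.range_comp, AddMonoidHom.range_eq_top.2 e.surjective, ← ha,
      AddMonoidHom.range_eq_map]

lemma IsSplitSurjMod.addEquiv_comp {a : M →+ X} {K : AddSubgroup M} (ha : IsSplitSurjMod a K)
    (e : X ≃+ H) : IsSplitSurjMod (e.toAddMonoidHom.comp a) K := by
  obtain ⟨⟨r, hr⟩, ha⟩ := ha
  refine ⟨⟨r.comp e.symm.toAddMonoidHom, fun x => ?_⟩, ?_⟩
  · change e (a (r (e.symm x))) = x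
    rw [hr, e.apply_symm_apply]
  · rw [← ha]
    ext m
    exact e.map_eq_zero_iff

end Algebra

/-- The additive equivalence underlying an isomorphism of abelian groups. -/
noncomputable def addEquivOfIsIso {G H : AddCommGrpCat.{w}} (f : G ⟶ H) [IsIso f] : G ≃+ H :=
  (asIso f).addCommGroupIsoToAddEquiv

lemma isSplitInjOnto_of_isIso {G H : AddCommGrpCat.{w}} (f : G ⟶ H) [IsIso f] :
    IsSplitInjOnto f.hom ⊤ :=
  ⟨⟨(addEquivOfIsIso f).symm.toAddMonoidHom, (addEquivOfIsIso f).symm_apply_apply⟩,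
    AddMonoidHom.range_eq_top.2 (addEquivOfIsIso f).surjective⟩

lemma isSplitSurjMod_of_isIso {G H : AddCommGrpCat.{w}} (f : G ⟶ H) [IsIso f] :
    IsSplitSurjMod f.hom ⊥ :=
  ⟨⟨(addEquivOfIsIso f).symm.toAddMonoidHom, (addEquivOfIsIso f).apply_symm_apply⟩,
    (AddMonoidHom.ker_eq_bot_iff _).2 (addEquivOfIsIso f).injective⟩

/-! ### Induction over the directions of a retractive cube -/

namespace Cube

variable {k : ℕ} {χ : Cube k Spectrum.{u}}

lemma eqToHom_eq_toHo_map {S T : Finset (Fin k)} (h : S = T)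
    (h' : toHo.obj (χ.obj S) = toHo.obj (χ.obj T)) :
    eqToHom h' = toHo.map (χ.map (homOfLE h.le)) := by
  subst h
  have : χ.map (homOfLE (le_refl S)) = 𝟙 _ := χ.map_id S
  rw [this, toHo.map_id, eqToHom_refl]

/-- This splits the face from `B` to `C'` into two opposite faces in direction `j`, both with
remaining directions `A`, so that the induction hypothesis applies to each. -/
lemma exists_eq_insert_of_sdiff {A B C' : Finset (Fin k)} {j : Fin k} (h : B ⊆ C')
    (hA : C' \ B = insert j A) (hj : j ∉ A) :
    j ∉ B ∧ (∀ i ∈ A, i ∉ B) ∧ ∃ C, j ∉ C ∧ C' = insert j C ∧ B ⊆ C ∧ C \ B = A ∧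
      insert j C \ insert j B = A := by
  have hmem (i) : i ∈ C' ∧ i ∉ B ↔ i = j ∨ i ∈ A := by
    rw [← Finset.mem_sdiff, hA, Finset.mem_insert]
  have hjB := ((hmem j).2 (.inl rfl)).2
  refine ⟨hjB, fun i hi => ((hmem i).2 (.inr hi)).2, C'.erase j, Finset.notMem_erase _ _,
    (Finset.insert_erase ((hmem j).2 (.inl rfl)).1).symm, Finset.subset_erase.2 ⟨h, hjB⟩, ?_, ?_⟩ <;>
  · ext i
    have := hmem i
    grind

lemma edge_comp_edge (U : Finset (Fin k)) (i j : Fin k) :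
    edge χ U j ≫
        χ.map (homOfLE (Finset.insert_subset_insert j (Finset.subset_insert i U))) =
      edge χ U i ≫ edge χ (insert i U) j := by
  simp only [edge, ← χ.map_comp, homOfLE_comp]

/-- The part of the structure of a retractive cube which is used: homotopy sections and their
compatibility with the edges in earlier directions. -/
lemma Retractive.exists_sections (hχ : χ.Retractive) :
    ∃ s : ∀ (U : Finset (Fin k)) (j : Fin k), j ∉ U →
        (toHo.obj (χ.obj (insert j U)) ⟶ toHo.obj (χ.obj U)),
      (∀ U j hj, IsIso (s U j hj ≫ toHo.map (edge χ U j))) ∧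
      ∀ (U : Finset (Fin k)) (i j : Fin k) (hj : j ∉ U), i ∉ U → i < j →
        ∃ hj' : j ∉ insert i U,
          s U j hj ≫ toHo.map (edge χ U i) =
            toHo.map (χ.map (homOfLE (Finset.insert_subset_insert j (Finset.subset_insert i U)))) ≫
              s (insert i U) j hj' ∧
          (s U j hj ≫ toHo.map (edge χ U j)) ≫ toHo.map (χ.map (homOfLE
              (Finset.insert_subset_insert j (Finset.subset_insert i U)))) =
            toHo.map (χ.map (homOfLE (Finset.insert_subset_insert j (Finset.subset_insert i U)))) ≫
              s (insert i U) j hj' ≫ toHo.map (edge χ (insert i U) j) := by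
  obtain ⟨s, h₁, -, h₃⟩ := hχ
  refine ⟨s, h₁, fun U i j hj hi hij => ?_⟩
  have hj' : j ∉ insert i U := by simp [hj, hij.ne']
  have h : s U j hj ≫ toHo.map (edge χ U i) = toHo.map (χ.map (homOfLE
      (Finset.insert_subset_insert j (Finset.subset_insert i U)))) ≫ s (insert i U) j hj' := by
    rw [h₃ U i j hi hj hij, eqToHom_eq_toHo_map (Finset.insert_comm i j U), ← Category.assoc,
      ← toHo.map_comp, edge, ← χ.map_comp, homOfLE_comp]
  refine ⟨hj', h, ?_⟩
  -- Pasting the mixed square with a commuting square of edges shows that "section, then edge" is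
  -- compatible with the edges in direction `i`.
  rw [Category.assoc, ← toHo.map_comp, edge_comp_edge, toHo.map_comp, ← Category.assoc, h,
    Category.assoc]

/-- The common kernel of the homomorphisms induced by the edges from `χ(U)` in directions `A`. -/
noncomputable def edgeKernel (χ : Cube k Spectrum.{u}) (F : Ho.{u} ⥤ AddCommGrpCat.{w})
    (U A : Finset (Fin k)) : AddSubgroup (F.obj (toHo.obj (χ.obj U))) :=
  ⨅ i ∈ A, (F.map (toHo.map (edge χ U i))).hom.ker

/-- The sum of the images of the homomorphisms induced by the edges from `χ(U)` in directions
`A`. -/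
noncomputable def edgeRange (χ : Cube k Spectrum.{u}) (F : Ho.{u}ᵒᵖ ⥤ AddCommGrpCat.{w})
    (U A : Finset (Fin k)) : AddSubgroup (F.obj (.op (toHo.obj (χ.obj U)))) :=
  ⨆ i ∈ A, (F.map (toHo.map (edge χ U i)).op).hom.range

lemma ker_map_congr (F : Ho.{u} ⥤ AddCommGrpCat.{w}) {U S T : Finset (Fin k)} (hS : U ⊆ S)
    (hT : U ⊆ T) (h : S = T) :
    (F.map (toHo.map (χ.map (homOfLE hS)))).hom.ker =
      (F.map (toHo.map (χ.map (homOfLE hT)))).hom.ker := by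
  subst h
  rfl

lemma range_map_congr (F : Ho.{u}ᵒᵖ ⥤ AddCommGrpCat.{w}) {U S T : Finset (Fin k)} (hS : U ⊆ S)
    (hT : U ⊆ T) (h : S = T) :
    (F.map (toHo.map (χ.map (homOfLE hS))).op).hom.range =
      (F.map (toHo.map (χ.map (homOfLE hT))).op).hom.range := by
  subst h
  rfl

/-- The edges are rewritten to end at `insert j (insert i U)`, the vertex used in
`Retractive.exists_sections`. -/
lemma mem_edgeKernel_insert {F : Ho.{u} ⥤ AddCommGrpCat.{w}} {U A : Finset (Fin k)} {j : Fin k}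
    {y : F.obj (toHo.obj (χ.obj (insert j U)))} :
    y ∈ edgeKernel χ F (insert j U) A ↔ ∀ i ∈ A,
      (F.map (toHo.map (χ.map (homOfLE
        (Finset.insert_subset_insert j (Finset.subset_insert i U)))))).hom y = 0 := by
  simp only [edgeKernel, AddSubgroup.mem_iInf]
  refine forall₂_congr fun i _ => ?_
  rw [edge, ker_map_congr F _ _ (Finset.insert_comm i j U), AddMonoidHom.mem_ker]

lemma edgeRange_insert {F : Ho.{u}ᵒᵖ ⥤ AddCommGrpCat.{w}} {U A : Finset (Fin k)} {j : Fin k} :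
    edgeRange χ F (insert j U) A = ⨆ i ∈ A,
      (F.map (toHo.map (χ.map (homOfLE
        (Finset.insert_subset_insert j (Finset.subset_insert i U))))).op).hom.range := by
  refine iSup_congr fun i => iSup_congr fun _ => ?_
  rw [edge, range_map_congr F _ _ (Finset.insert_comm i j U)]

lemma iterFiberι_insert {B C : Finset (Fin k)} {j : Fin k} (hj : j ∉ B) (h : B ⊆ C) :
    iterFiberι χ (h.trans (Finset.subset_insert j C)) =
      iterFiberCurry χ hj ≫ hofiberι _ ≫ iterFiberι χ h :=
  rfl

lemma congr_hom {G H : AddCommGrpCat.{w}} {f g : G ⟶ H} (h : f = g) (x : G) : f.hom x = g.hom x :=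
  h ▸ rfl

/-- Induction adds a new largest direction `j`, as the mixed squares require. All `B`, `C` and `n`
are treated at once, because a step uses two opposite faces and two adjacent degrees. -/
theorem homology_iterFiber (hχ : χ.Retractive) (E : HomologyTheory.{u, w}) (A : Finset (Fin k)) :
    ∀ (B C : Finset (Fin k)) (h : B ⊆ C), C \ B = A → ∀ n : ℤ,
      IsSplitInjOnto ((E.onSpectra n).map (iterFiberι χ h)).hom (edgeKernel χ (E.obj n) B A) := by
  obtain ⟨s, hs, hs'⟩ := hχ.exists_sections
  induction A using Finset.induction_on_max with
  | empty =>
    intro B C h hA n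
    obtain rfl : B = C := h.antisymm (Finset.sdiff_eq_empty_iff_subset.1 hA)
    have := isIso_iterFiberι_self (χ := χ) (B := B)
    simpa [edgeKernel] using isSplitInjOnto_of_isIso ((E.onSpectra n).map (iterFiberι χ h))
  | insert j A hj ih =>
    intro B C' h' hA
    have hjA : j ∉ A := fun h => lt_irrefl _ (hj j h)
    obtain ⟨hjB, hAB, C, hjC, rfl, h, hA₁, hA₂⟩ := exists_eq_insert_of_sdiff h' hA hjA
    have iha := ih B C h hA₁
    have ihb := ih (insert j B) (insert j C) (Finset.insert_subset_insert j h) hA₂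
    let f := iterFiberEdge χ (C := C) hjB
    have hf (n : ℤ) (x) : ((E.onSpectra n).map (iterFiberι χ (Finset.insert_subset_insert j h))).hom
        (((E.onSpectra n).map f).hom x) = ((E.onSpectra n).map (edge χ B j)).hom
          (((E.onSpectra n).map (iterFiberι χ h)).hom x) := by
      have := congrArg (E.onSpectra n).map (iterFiberEdge_ι (χ := χ) hjB h)
      simp only [Functor.map_comp] at this
      exact congr_hom this x
    have hc (n : ℤ) : ∃ c : (E.onSpectra n).obj _ →+ (E.onSpectra n).obj _,
        ∀ y, ((E.onSpectra n).map f).hom (c y) = y := by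
      have hB := hs B j hjB
      refine exists_section_of_section_ambient (s := ((E.obj n).map (s B j hjB)).hom) (iha n)
        (ihb n) (hf n) (addEquivOfIsIso ((E.obj n).map (s B j hjB ≫ toHo.map (edge χ B j)))) ?_ ?_ ?_
      · intro y
        exact congr_hom ((E.obj n).map_comp _ _) y
      -- The mixed square: an edge in direction `i` after the section factors through an edge that
      -- kills `y`.
      · intro y hy
        rw [mem_edgeKernel_insert] at hy
        simp only [edgeKernel, AddSubgroup.mem_iInf, AddMonoidHom.mem_ker]
        intro i hi
        obtain ⟨hji, h₁, -⟩ := hs' B i j hjB (hAB i hi) (hj i hi)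
        have := congrArg (E.obj n).map h₁
        simp only [Functor.map_comp] at this
        refine (congr_hom this y).trans ?_
        rw [AddCommGrpCat.hom_comp, AddMonoidHom.comp_apply, hy i hi, map_zero]
      -- An edge sends `g y` to the image of its value at `y` under the analogous composite over
      -- `insert i B`, which is invertible; so if `g y` is killed, then `y` is.
      · intro y hy
        rw [mem_edgeKernel_insert] at hy ⊢
        intro i hi
        obtain ⟨hji, -, h₂⟩ := hs' B i j hjB (hAB i hi) (hj i hi)
        have := hs (insert i B) j hji
        have := ((E.obj n).map_comp _ _).symm.trans
          ((congrArg (E.obj n).map h₂).trans ((E.obj n).map_comp _ _))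
        have := (congr_hom this y).symm.trans (hy i hi)
        exact (addEquivOfIsIso ((E.obj n).map
          (s (insert i B) j hji ≫ toHo.map (edge χ (insert i B) j)))).map_eq_zero_iff.1 this
    intro n
    -- Surjectivity of `f` in degree `n + 1` makes the boundary map vanish.
    have hι : Function.Injective ((E.onSpectra n).map (hofiberι f)).hom := by
      refine (injective_iff_map_eq_zero _).2 fun x hx => ?_
      obtain ⟨y, rfl⟩ := (E.exact_left f n x).1 hx
      obtain ⟨c, hc⟩ := hc (n + 1)
      exact (E.exact_right f n y).2 ⟨c y, hc y⟩
    obtain ⟨c, hc⟩ := hc n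
    have key := isSplitInjOnto_ker (iha n) (ihb n) (hf n) hι (E.exact_middle f n) hc
    have := isIso_iterFiberCurry (χ := χ) hjB hjC
    have := key.comp_addEquiv
      (addEquivOfIsIso ((E.onSpectra n).map (iterFiberCurry χ (C := C) hjB)))
    rw [edgeKernel, Finset.iInf_insert, inf_comm, iterFiberι_insert hjB h, Functor.map_comp,
      Functor.map_comp]
    exact this

theorem cohomology_iterFiber (hχ : χ.Retractive) (E : CohomologyTheory.{u, w})
    (A : Finset (Fin k)) : ∀ (B C : Finset (Fin k)) (h : B ⊆ C), C \ B = A → ∀ n : ℤ,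
      IsSplitSurjMod ((E.onSpectra n).map (iterFiberι χ h).op).hom
        (edgeRange χ (E.obj n) B A) := by
  obtain ⟨s, hs, hs'⟩ := hχ.exists_sections
  induction A using Finset.induction_on_max with
  | empty =>
    intro B C h hA n
    obtain rfl : B = C := h.antisymm (Finset.sdiff_eq_empty_iff_subset.1 hA)
    have := isIso_iterFiberι_self (χ := χ) (B := B)
    simpa [edgeRange] using isSplitSurjMod_of_isIso ((E.onSpectra n).map (iterFiberι χ h).op)
  | insert j A hj ih =>
    intro B C' h' hA
    have hjA : j ∉ A := fun h => lt_irrefl _ (hj j h)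
    obtain ⟨hjB, hAB, C, hjC, rfl, h, hA₁, hA₂⟩ := exists_eq_insert_of_sdiff h' hA hjA
    have iha := ih B C h hA₁
    have ihb := ih (insert j B) (insert j C) (Finset.insert_subset_insert j h) hA₂
    let f := iterFiberEdge χ (C := C) hjB
    have hf (n : ℤ) (x) : ((E.onSpectra n).map f.op).hom (((E.onSpectra n).map
        (iterFiberι χ (Finset.insert_subset_insert j h)).op).hom x) =
          ((E.onSpectra n).map (iterFiberι χ h).op).hom
            (((E.onSpectra n).map (edge χ B j).op).hom x) := by
      have := congrArg (fun g => (E.onSpectra n).map g.op) (iterFiberEdge_ι (χ := χ) hjB h)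
      simp only [op_comp, Functor.map_comp] at this
      exact congr_hom this x
    have hc (n : ℤ) : ∃ c : (E.onSpectra n).obj _ →+ (E.onSpectra n).obj _,
        ∀ y, c (((E.onSpectra n).map f.op).hom y) = y := by
      have hB := hs B j hjB
      refine exists_retraction_of_retraction_ambient (s := ((E.obj n).map (s B j hjB).op).hom)
        (iha n) (ihb n) (hf n)
        (addEquivOfIsIso ((E.obj n).map (s B j hjB ≫ toHo.map (edge χ B j)).op)) ?_ ?_ ?_
      · intro y
        exact congr_hom ((E.obj n).map_comp (toHo.map (edge χ B j)).op (s B j hjB).op) y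
      · suffices edgeRange χ (E.obj n) B A ≤ (edgeRange χ (E.obj n) (insert j B) A).comap
            ((E.obj n).map (s B j hjB).op).hom from fun m hm => this hm
        refine iSup₂_le fun i hi => ?_
        rintro _ ⟨z, rfl⟩
        obtain ⟨hji, h₁, -⟩ := hs' B i j hjB (hAB i hi) (hj i hi)
        have := congrArg (fun g => (E.obj n).map g.op) h₁
        simp only [op_comp, Functor.map_comp] at this
        rw [AddSubgroup.mem_comap, edgeRange_insert]
        refine AddSubgroup.mem_iSup_of_mem i (AddSubgroup.mem_iSup_of_mem hi ?_)
        exact ⟨_, (congr_hom this z).symm⟩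
      · let g := addEquivOfIsIso ((E.obj n).map (s B j hjB ≫ toHo.map (edge χ B j)).op)
        -- Reflecting membership in the sum of images amounts to `L ≤ g(L)`. A generator of `L`
        -- comes from some `z` over `insert i B`; lifting `z` through the automorphism there
        -- exhibits it as `g` of a generator.
        suffices edgeRange χ (E.obj n) (insert j B) A ≤
            (edgeRange χ (E.obj n) (insert j B) A).map g.toAddMonoidHom by
          intro y hy
          obtain ⟨y', hy', hyy'⟩ := this hy
          exact g.injective hyy' ▸ hy'
        nth_rw 1 [edgeRange_insert]
        refine iSup₂_le fun i hi => ?_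
        rintro _ ⟨z, rfl⟩
        obtain ⟨hji, -, h₂⟩ := hs' B i j hjB (hAB i hi) (hj i hi)
        have := hs (insert i B) j hji
        have h₂' := congrArg Quiver.Hom.op h₂
        rw [op_comp, op_comp] at h₂'
        have := ((E.obj n).map_comp _ _).symm.trans
          ((congrArg (E.obj n).map h₂').trans ((E.obj n).map_comp _ _))
        obtain ⟨z, rfl⟩ := (addEquivOfIsIso ((E.obj n).map
          (s (insert i B) j hji ≫ toHo.map (edge χ (insert i B) j)).op)).surjective z
        refine ⟨_, ?_, congr_hom this z⟩
        rw [edgeRange_insert]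
        exact AddSubgroup.mem_iSup_of_mem i (AddSubgroup.mem_iSup_of_mem hi ⟨z, rfl⟩)
    intro n
    -- The coboundary lands in the kernel of the map induced by `f` in degree `n + 1`, which is
    -- injective, so it vanishes.
    have hι : Function.Surjective ((E.onSpectra n).map (hofiberι f).op).hom := by
      intro x
      refine (E.exact_middle f n x).1 ?_
      obtain ⟨c, hc⟩ := hc (n + 1)
      have h0 := (E.exact_right f n _).2 ⟨x, rfl⟩
      rw [← hc ((E.δ f n).hom x)]
      exact (congrArg c h0).trans (map_zero c)
    obtain ⟨c, hc⟩ := hc n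
    have key := isSplitSurjMod_coker (iha n) (ihb n) (hf n) hι (E.exact_left f n) hc
    have := isIso_iterFiberCurry (χ := χ) hjB hjC
    have := key.addEquiv_comp
      (addEquivOfIsIso ((E.onSpectra n).map (iterFiberCurry χ (C := C) hjB).op))
    rw [edgeRange, Finset.iSup_insert, sup_comm, iterFiberι_insert hjB h, op_comp, op_comp,
      Functor.map_comp, Functor.map_comp]
    exact this

/-! ### Passage to the total fibre, total kernel and total cokernel -/

lemma tfiberι_eq : tfiberι χ = @inv _ _ _ _ (iterFiberToTfiber χ) (isIso_iterFiberToTfiber χ) ≫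
    iterFiberι χ (Finset.empty_subset Finset.univ) := by
  have := isIso_iterFiberToTfiber χ
  rw [IsIso.eq_inv_comp, iterFiberToTfiber_ι]

lemma tkernel_eq (F : Ho.{u} ⥤ AddCommGrpCat.{w}) :
    tkernel (χ ⋙ toHo ⋙ F) = edgeKernel χ F ∅ Finset.univ := by
  ext x
  simp only [edgeKernel, AddSubgroup.mem_iInf, tkernel, AddMonoidHom.mem_ker]
  refine funext_iff.trans (forall_congr' fun i => ?_)
  rw [← AddMonoidHom.mem_ker, edge, ker_map_congr F _ (Finset.empty_subset {i})
    (insert_empty_eq i)]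
  simp only [Finset.mem_univ, forall_true_left]
  rfl

open scoped DirectSum in
lemma range_toAddMonoid {ι : Type*} [DecidableEq ι] {G : ι → Type*} [∀ i, AddCommGroup (G i)]
    {M : Type*} [AddCommGroup M] (φ : ∀ i, G i →+ M) :
    (DirectSum.toAddMonoid φ).range = ⨆ i, (φ i).range := by
  refine le_antisymm ?_ (iSup_le fun i => ?_)
  · rintro _ ⟨x, rfl⟩
    induction x using DirectSum.induction_on with
    | zero => simp
    | of i x =>
      rw [DirectSum.toAddMonoid_of]
      exact AddSubgroup.mem_iSup_of_mem i ⟨x, rfl⟩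
    | add x y hx hy =>
      rw [map_add]
      exact add_mem hx hy
  · rintro _ ⟨x, rfl⟩
    exact ⟨DirectSum.of G i x, DirectSum.toAddMonoid_of φ i x⟩

lemma edgeRange_empty_univ (F : Ho.{u}ᵒᵖ ⥤ AddCommGrpCat.{w}) :
    (DirectSum.toAddMonoid fun i : Fin k =>
      ((χ.op ⋙ toHo.op ⋙ F).map (homOfLE (Finset.empty_subset {i})).op).hom).range =
        edgeRange χ F ∅ Finset.univ := by
  rw [range_toAddMonoid, edgeRange]
  refine iSup_congr fun i => ?_
  rw [edge, range_map_congr F _ (Finset.empty_subset {i}) (insert_empty_eq i)]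
  simp only [Finset.mem_univ, iSup_pos]
  rfl

end Cube
end CubeSpectra

theorem lemma5p1 {k : ℕ} (χ : CubeSpectra.Cube k CubeSpectra.Spectrum.{u}) (hχ : χ.Retractive) :
    (∀ (E : CubeSpectra.HomologyTheory.{u, w}) (n : ℤ),
      IsSplitMono ((E.onSpectra n).map χ.tfiberι) ∧
      ∃ e : (E.onSpectra n).obj χ.tfiber ≃+ CubeSpectra.Cube.tkernel (χ ⋙ E.onSpectra n),
        ∀ x : (E.onSpectra n).obj χ.tfiber,
          (e x).1 = (E.onSpectra n).map χ.tfiberι x) ∧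
    (∀ (E : CubeSpectra.CohomologyTheory.{u, w}) (n : ℤ),
      IsSplitEpi ((E.onSpectra n).map χ.tfiberι.op) ∧
      ∃ e : CubeSpectra.Cube.tcokernel (χ.op ⋙ E.onSpectra n) ≃+ (E.onSpectra n).obj (.op χ.tfiber),
        ∀ x : (E.onSpectra n).obj (.op (χ.obj ∅)),
          e (QuotientAddGroup.mk x) = (E.onSpectra n).map χ.tfiberι.op x) := by
  have := CubeSpectra.Cube.isIso_iterFiberToTfiber χ
  refine ⟨fun E n => ?_, fun E n => ?_⟩
  · obtain ⟨⟨r, hr⟩, hK⟩ : CubeSpectra.IsSplitInjOnto ((E.onSpectra n).map χ.tfiberι).hom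
        (CubeSpectra.Cube.tkernel (χ ⋙ E.onSpectra n)) := by
      rw [CubeSpectra.Cube.tkernel_eq, CubeSpectra.Cube.tfiberι_eq, Functor.map_comp]
      exact (CubeSpectra.Cube.homology_iterFiber hχ E Finset.univ ∅ Finset.univ _
        Finset.sdiff_empty n).comp_addEquiv
          (CubeSpectra.addEquivOfIsIso ((E.onSpectra n).map
            (inv (CubeSpectra.Cube.iterFiberToTfiber χ))))
    refine ⟨⟨⟨AddCommGrpCat.ofHom r, ?_⟩⟩, ?_⟩
    · ext x
      exact hr x
    · exact ⟨(AddMonoidHom.ofInjective (Function.LeftInverse.injective hr)).trans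
        (AddEquiv.addSubgroupCongr hK), fun x => rfl⟩
  · obtain ⟨⟨r, hr⟩, hK⟩ : CubeSpectra.IsSplitSurjMod ((E.onSpectra n).map χ.tfiberι.op).hom
        (DirectSum.toAddMonoid fun i : Fin k =>
          ((χ.op ⋙ E.onSpectra n).map (homOfLE (Finset.empty_subset {i})).op).hom).range := by
      rw [CubeSpectra.Cube.edgeRange_empty_univ, CubeSpectra.Cube.tfiberι_eq, op_comp,
        Functor.map_comp]
      exact (CubeSpectra.Cube.cohomology_iterFiber hχ E Finset.univ ∅ Finset.univ _
        Finset.sdiff_empty n).addEquiv_comp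
          (CubeSpectra.addEquivOfIsIso ((E.onSpectra n).map
            (inv (CubeSpectra.Cube.iterFiberToTfiber χ)).op))
    refine ⟨⟨⟨AddCommGrpCat.ofHom r, ?_⟩⟩, ?_⟩
    · ext x
      exact hr x
    · exact ⟨(QuotientAddGroup.quotientAddEquivOfEq hK.symm).trans
        (QuotientAddGroup.quotientKerEquivOfSurjective _ (Function.RightInverse.surjective hr)),
        fun x => rfl⟩
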